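/- Let $G=(V,E)$ be a directed graph with $|V|=N$ nodes and $|E|=M$ edges (parallel edges and loops allowed), with nominal costs $\hat c\in\mathbb{R}^E$, $\hat c\ge 0$, and nodes $s,t\in V$ such that $G$ contains at least one path from $s$ to $t$. Let $\mathcal{X}\subseteq\{0,1\}^E$ be the set of incidence vectors of the (simple) paths from $s$ to $t$. For $\lambda\ge 0$ let $\mathcal{U}_\lambda=\{\hat c\}+\lambda B$ with $B=[-1,1]^E$ (constant growth), and let $\mathsf{P}(\lambda)$ be the robust problem $$\min_{x\in\mathcal{X}}\ \max_{c\in\mathcal{U}_\lambda} c^t x .$$ A solution of the variable-sized robust shortest path problem with constant growth is a set $\mathcal{S}\subseteq\mathcal{X}$ of smallest possible cardinality such that for every $\lambda\ge 0$ the set $\mathcal{S}$ contains an optimal solution of $\mathsf{P}(\lambda)$. **Theorem.** The variable-sized robust shortest path problem with constant growth can be solved in time $O(NM+N^2\log N)$, and $|\mathcal{S}|\le N$. Precisely: there are a program for the unit-cost real RAM (a random access machine with natural-number registers and memory, with addition, truncated subtraction, comparison and indirect addressing, and with real-number registers and memory, with $+,-,\times,\div$ and comparison) and a constant $C$, both independent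 of the instance, such that on every instance as above, given by $N$, $M$, $s$, $t$ and the list of edges with their costs, the program halts after at most $C\,(NM+N^2\log N+1)$ steps and outputs, as edge sequences and without repetition, the $s$-$t$ paths whose incidence vectors form a solution $\mathcal{S}$, and $|\mathcal{S}|\le N$. (The summand $1$ matters only for $N=1$, where $\log N=0$.) -/

import Mathlib

/-! ### Variable-sized min-max robust optimization -/

namespace VarRobust

/-- The uncertainty set `{ĉ} + lam • B`. -/
def uncertaintySet {E : Type*} (chat : E → ℝ) (B : Set (E → ℝ)) (lam : ℝ) : Set (E → ℝ) :=
  {c | ∃ b ∈ B, c = chat + lam • b}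

/-- Constant growth: `B` is the box `∏ [-1, 1]`. -/
def constantGrowthBox (E : Type*) : Set (E → ℝ) :=
  {b | ∀ e, -1 ≤ b e ∧ b e ≤ 1}

/-- The worst-case objective value `max_{c ∈ U} cᵗ x`
(attained for the sets `U` used here, see `isGreatest_robustCost`). -/
noncomputable def robustCost {E : Type*} [Fintype E] (U : Set (E → ℝ)) (x : E → ℝ) : ℝ :=
  sSup ((fun c : E → ℝ => ∑ e, c e * x e) '' U)

theorem isGreatest_robustCost {E : Type*} [Fintype E] (chat : E → ℝ) (lam : ℝ) (x : E → ℝ) :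
    IsGreatest ((fun c : E → ℝ => ∑ e, c e * x e) ''
        uncertaintySet chat (constantGrowthBox E) lam)
      (robustCost (uncertaintySet chat (constantGrowthBox E) lam) x) := by
  have hB : constantGrowthBox E = Set.Icc (fun _ => -1) (fun _ => 1) := by
    ext b
    simp [constantGrowthBox, Set.mem_Icc, Pi.le_def, forall_and]
  have hU : uncertaintySet chat (constantGrowthBox E) lam
      = (fun b : E → ℝ => chat + lam • b) '' Set.Icc (fun _ => -1) (fun _ => 1) := by
    rw [← hB]
    ext c
    simp [uncertaintySet, eq_comm]
  have hc : IsCompact (uncertaintySet chat (constantGrowthBox E) lam) := by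
    rw [hU]
    exact isCompact_Icc.image (by fun_prop)
  have hne : (uncertaintySet chat (constantGrowthBox E) lam).Nonempty :=
    ⟨chat + lam • 0, 0, fun e => by simp, rfl⟩
  exact (hc.image (by fun_prop)).isGreatest_sSup (hne.image _)

/-- `x` is an optimal solution of `min_{x ∈ X} max_{c ∈ U} cᵗ x`. -/
def IsRobustOptimal {E : Type*} [Fintype E] (X U : Set (E → ℝ)) (x : E → ℝ) : Prop :=
  x ∈ X ∧ ∀ y ∈ X, robustCost U x ≤ robustCost U y

/-- `S ⊆ X` contains, for every size `lam ≥ 0`, an optimal solution of the robust problem. -/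
def IsCovering {E : Type*} [Fintype E] (X : Set (E → ℝ)) (chat : E → ℝ) (B : Set (E → ℝ))
    (S : Set (E → ℝ)) : Prop :=
  S ⊆ X ∧ ∀ lam : ℝ, 0 ≤ lam → ∃ x ∈ S, IsRobustOptimal X (uncertaintySet chat B lam) x

/-- `S` solves the variable-sized robust problem: it is a smallest possible covering set. -/
def IsSolution {E : Type*} [Fintype E] (X : Set (E → ℝ)) (chat : E → ℝ) (B : Set (E → ℝ))
    (S : Set (E → ℝ)) : Prop :=
  IsCovering X chat B S ∧ ∀ S' : Set (E → ℝ), IsCovering X chat B S' → S.encard ≤ S'.encard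

/-! ### Shortest path instances -/

/-- A directed graph with `N` nodes and `M` edges (parallel edges and loops are allowed),
a start node, an end node, and nominal edge costs. -/
structure PathInstance where
  N : ℕ
  M : ℕ
  tail : Fin M → Fin N
  head : Fin M → Fin N
  source : Fin N
  target : Fin N
  cost : Fin M → ℝ

namespace PathInstance

/-- The edge sequence `p` leads from `u` to `v`. -/
def IsWalk (G : PathInstance) : Fin G.N → List (Fin G.M) → Fin G.N → Prop
  | u, [], v => u = v
  | u, e :: p, v => G.tail e = u ∧ G.IsWalk (G.head e) p v

/-- `p` is the edge sequence of a path from `source` to `target` (no node is visited twice). -/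
def IsPath (G : PathInstance) (p : List (Fin G.M)) : Prop :=
  G.IsWalk G.source p G.target ∧ (G.source :: p.map G.head).Nodup

/-- The incidence vector of an edge sequence. -/
def incidence (G : PathInstance) (p : List (Fin G.M)) : Fin G.M → ℝ :=
  fun e => if e ∈ p then 1 else 0

/-- The feasible set: all incidence vectors of paths from `source` to `target`. -/
def feasibleSet (G : PathInstance) : Set (Fin G.M → ℝ) :=
  {x | ∃ p, G.IsPath p ∧ x = G.incidence p}

/-- A list of edge sequences, written as a list of numbers: the number of sequences, then for
each sequence its length followed by the indices of its edges. -/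
def encodePaths (G : PathInstance) (ps : List (List (Fin G.M))) : List ℕ :=
  ps.length :: ps.flatMap (fun p => p.length :: p.map (fun e => (e : ℕ)))

end PathInstance

/-! ### A random access machine with real registers (real RAM), unit cost -/

/-- Instructions. `i`-registers and the `i`-memory hold natural numbers, `r`-registers and the
`r`-memory hold real numbers. Memory is addressed by the contents of an `i`-register. -/
inductive Instr where
  | iconst (a : ℕ) (k : ℕ)
  | icopy (a b : ℕ)
  | iadd (a b c : ℕ)
  | isub (a b c : ℕ)
  | iload (a b : ℕ)
  | istore (a b : ℕ)
  | rconst (a : ℕ) (k : ℤ)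
  | rcopy (a b : ℕ)
  | radd (a b c : ℕ)
  | rsub (a b c : ℕ)
  | rmul (a b c : ℕ)
  | rdiv (a b c : ℕ)
  | rload (a b : ℕ)
  | rstore (a b : ℕ)
  | ijumple (a b : ℕ) (l : ℕ)
  | rjumple (a b : ℕ) (l : ℕ)
  | output (a : ℕ)
  | halt

/-- A machine configuration: program counter, registers, memories, and the output so far. -/
structure Config where
  pc : ℕ
  ireg : ℕ → ℕ
  rreg : ℕ → ℝ
  imem : ℕ → ℕ
  rmem : ℕ → ℝ
  out : List ℕ

namespace Config

def next (σ : Config) : Config := { σ with pc := σ.pc + 1 }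

def setI (σ : Config) (a k : ℕ) : Config := { σ with ireg := Function.update σ.ireg a k }

def setR (σ : Config) (a : ℕ) (z : ℝ) : Config := { σ with rreg := Function.update σ.rreg a z }

end Config

/-- The effect of one instruction; `none` for `halt` and for a division by zero. -/
noncomputable def Instr.exec (ins : Instr) (σ : Config) : Option Config :=
  match ins with
  | .iconst a k => some (σ.setI a k).next
  | .icopy a b => some (σ.setI a (σ.ireg b)).next
  | .iadd a b c => some (σ.setI a (σ.ireg b + σ.ireg c)).next
  | .isub a b c => some (σ.setI a (σ.ireg b - σ.ireg c)).next
  | .iload a b => some (σ.setI a (σ.imem (σ.ireg b))).next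
  | .istore a b => some
      { σ with imem := Function.update σ.imem (σ.ireg a) (σ.ireg b), pc := σ.pc + 1 }
  | .rconst a k => some (σ.setR a (k : ℝ)).next
  | .rcopy a b => some (σ.setR a (σ.rreg b)).next
  | .radd a b c => some (σ.setR a (σ.rreg b + σ.rreg c)).next
  | .rsub a b c => some (σ.setR a (σ.rreg b - σ.rreg c)).next
  | .rmul a b c => some (σ.setR a (σ.rreg b * σ.rreg c)).next
  | .rdiv a b c =>
      if σ.rreg c = 0 then none else some (σ.setR a (σ.rreg b / σ.rreg c)).next
  | .rload a b => some (σ.setR a (σ.rmem (σ.ireg b))).next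
  | .rstore a b => some
      { σ with rmem := Function.update σ.rmem (σ.ireg a) (σ.rreg b), pc := σ.pc + 1 }
  | .ijumple a b l =>
      if σ.ireg a ≤ σ.ireg b then some { σ with pc := l } else some σ.next
  | .rjumple a b l =>
      if σ.rreg a ≤ σ.rreg b then some { σ with pc := l } else some σ.next
  | .output a => some { σ with out := σ.out ++ [σ.ireg a], pc := σ.pc + 1 }
  | .halt => none

/-- One step of the program `P`. -/
noncomputable def step (P : List Instr) (σ : Config) : Option Config :=
  P[σ.pc]?.bind (fun ins => ins.exec σ)

/-- Exactly `n` steps of the program `P`. -/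
noncomputable def run (P : List Instr) : ℕ → Config → Option Config
  | 0, σ => some σ
  | n + 1, σ => (step P σ).bind (run P n)

/-- Started in `σ`, the program `P` reaches a `halt` instruction after exactly `n` steps, and
its output is then `o`. -/
def HaltsIn (P : List Instr) (σ : Config) (n : ℕ) (o : List ℕ) : Prop :=
  ∃ τ, run P n σ = some τ ∧ P[τ.pc]? = some Instr.halt ∧ τ.out = o

/-- The initial configuration for an instance: `N`, `M`, source and target in the registers
`0, 1, 2, 3`; tail and head of edge `e` in the cells `2 * e` and `2 * e + 1` of the `i`-memory;
the nominal cost of edge `e` in the cell `e` of the `r`-memory; everything else is zero. -/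
noncomputable def PathInstance.initConfig (G : PathInstance) : Config where
  pc := 0
  ireg := fun a =>
    if a = 0 then G.N else if a = 1 then G.M else if a = 2 then G.source
    else if a = 3 then G.target else 0
  rreg := fun _ => 0
  imem := fun a =>
    if h : a / 2 < G.M then
      (if a % 2 = 0 then (G.tail ⟨a / 2, h⟩ : ℕ) else (G.head ⟨a / 2, h⟩ : ℕ))
    else 0
  rmem := fun a => if h : a < G.M then G.cost ⟨a, h⟩ else 0
  out := []

end VarRobust

/-! For `lam ≥ 0` the worst case over the box puts every cost at its upper end, so a path `p` has
robust cost `walkCost p + lam * p.length`. Only the nominal cost and the number of edges matter: if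
`d k` is the least cost of a walk to the target with exactly `k` edges, the problem is to minimize
the lines `d k + lam * k`, `k < N`, over the half-line `lam ≥ 0`.

The selected indices are those that are the smallest minimizer for some `lam ≥ 0` (`IsBreak`). They
suffice, since every `lam` has a smallest minimizer (`exists_isBreak`). None can be spared: raising
`lam` slightly makes such an index the unique minimizer (`IsBreak.exists_unique_min`), so every
covering set contains a path with that many edges, and different indices require different paths. A
selected walk is automatically simple, because cutting out a cycle would give fewer edges at no
greater cost. This is `IsTable.isSolution`.

The numbers `d k` come from the Bellman recursion on the number of edges, at a cost of `O(M)` per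
row and `O(NM)` in all. Testing one index means comparing the lower bounds on `lam` imposed by
larger indices with the upper bounds imposed by smaller ones (`IsThreshold`), which takes `O(N)`,
hence `O(N²)` for all indices. Printing at most `N` walks with fewer than `N` edges is also `O(N²)`.
The program therefore runs in `O(NM + N²)` steps, and the logarithmic factor of the claimed bound is
needed only to absorb `N²`. Its correctness is a chain of loop invariants on configurations, each
carrying a step budget. -/

namespace VarRobust

/-! ### Walks, simple paths and their robust cost -/

namespace PathInstance

variable (G : PathInstance)

/-- The nominal cost of an edge sequence. -/
def walkCost (p : List (Fin G.M)) : ℝ := (p.map G.cost).sum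

@[simp] theorem walkCost_nil : G.walkCost [] = 0 := by simp [walkCost]

@[simp] theorem walkCost_cons (e : Fin G.M) (p : List (Fin G.M)) :
    G.walkCost (e :: p) = G.cost e + G.walkCost p := by simp [walkCost]

variable {G}

/-- A walk that returns to its start can be shortened to its last part. -/
theorem IsWalk.exists_drop (hc : ∀ e, 0 ≤ G.cost e) {v w : Fin G.N} :
    ∀ {p : List (Fin G.M)} {u : Fin G.N}, G.IsWalk u p w → v ∈ p.map G.head →
      ∃ q, G.IsWalk v q w ∧ q.length < p.length ∧ G.walkCost q ≤ G.walkCost p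
  | [], _, _, h => by simp at h
  | e :: p, u, hp, h => by
    rcases List.mem_cons.1 (List.map_cons ▸ h) with rfl | h
    · exact ⟨p, hp.2, by simp, by simpa using hc e⟩
    · obtain ⟨q, h1, h2, h3⟩ := IsWalk.exists_drop hc hp.2 h
      refine ⟨q, h1, h2.trans (by simp), h3.trans (by simpa using hc e)⟩

/-- A repeated node closes a cycle, and with nonnegative costs its removal shortens the walk without
raising the cost. Thus a walk that beats all shorter walks strictly is a path. -/
theorem IsWalk.nodup_or_shorter (hc : ∀ e, 0 ≤ G.cost e) {w : Fin G.N} :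
    ∀ {p : List (Fin G.M)} {u : Fin G.N}, G.IsWalk u p w →
      (u :: p.map G.head).Nodup ∨
        ∃ q, G.IsWalk u q w ∧ q.length < p.length ∧ G.walkCost q ≤ G.walkCost p
  | [], _, _ => by simp
  | e :: p, u, hp => by
    by_cases hu : u ∈ (e :: p).map G.head
    · exact .inr (IsWalk.exists_drop hc hp hu)
    rcases IsWalk.nodup_or_shorter hc hp.2 with h | ⟨q, h1, h2, h3⟩
    · exact .inl (List.nodup_cons.2 ⟨hu, by simpa using h⟩)
    · exact .inr ⟨e :: q, ⟨hp.1, h1⟩, by simpa using h2, by simpa using h3⟩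

theorem IsPath.length_lt {p : List (Fin G.M)} (hp : G.IsPath p) : p.length < G.N := by
  simpa using hp.2.length_le_card

theorem IsPath.nodup {p : List (Fin G.M)} (hp : G.IsPath p) : p.Nodup :=
  (List.nodup_cons.1 hp.2).2.of_map _

theorem sum_mul_incidence {p : List (Fin G.M)} (hp : p.Nodup) (c : Fin G.M → ℝ) :
    ∑ e, c e * G.incidence p e = (p.map c).sum := by
  rw [← List.sum_toFinset c hp]
  simp [incidence, Finset.sum_ite]
  congr 1
  ext; simp

theorem sum_incidence {p : List (Fin G.M)} (hp : p.Nodup) :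
    ∑ e, G.incidence p e = p.length := by
  simpa using sum_mul_incidence hp (fun _ => 1)

/-- Incidence vectors are nonnegative, so the all-ones corner of the box is the worst case, and it
adds `lam` once per edge. -/
theorem robustCost_incidence {p : List (Fin G.M)} (hp : p.Nodup) {lam : ℝ} (hl : 0 ≤ lam) :
    robustCost (uncertaintySet G.cost (constantGrowthBox (Fin G.M)) lam) (G.incidence p)
      = G.walkCost p + lam * p.length := by
  refine (isGreatest_robustCost G.cost lam (G.incidence p)).unique ⟨?_, ?_⟩
  · refine ⟨fun e => G.cost e + lam, ⟨fun _ => 1, fun _ => by norm_num, ?_⟩, ?_⟩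
    · ext; simp
    · simp only [sum_mul_incidence hp, walkCost, List.sum_map_add]
      simp [mul_comm]
  · rintro _ ⟨c, ⟨b, hb, rfl⟩, rfl⟩
    simp only
    rw [sum_mul_incidence hp]
    calc (p.map (G.cost + lam • b)).sum ≤ (p.map (fun e => G.cost e + lam)).sum := by
          refine List.sum_le_sum fun e _ => ?_
          simpa using mul_le_of_le_one_right hl (hb e).2
      _ = _ := by simp [walkCost, List.sum_map_add, mul_comm]

/-! ### Tables of shortest walks with a given number of edges -/

/-- One row of the table of shortest walks to the target, computed from the previous row
by the first `m` edges. In a row `nx`, the entry `0` stands for an unreachable node, the entry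
`e + 1` for a walk that starts with `e`. -/
structure IsNextRow (G : PathInstance) (m : ℕ) (nx₀ : ℕ → ℕ) (ds₀ : ℕ → ℝ) (nx₁ : ℕ → ℕ)
    (ds₁ : ℕ → ℝ) : Prop where
  exists_edge : ∀ v, nx₁ v ≠ 0 → ∃ e : Fin G.M, (e : ℕ) < m ∧ nx₁ v = e + 1 ∧
    (G.tail e : ℕ) = v ∧ nx₀ (G.head e) ≠ 0 ∧ ds₁ v = G.cost e + ds₀ (G.head e)
  le_edge : ∀ e : Fin G.M, (e : ℕ) < m → nx₀ (G.head e) ≠ 0 →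
    nx₁ (G.tail e) ≠ 0 ∧ ds₁ (G.tail e) ≤ G.cost e + ds₀ (G.head e)

/-- The rows `0, …, K` form the table of shortest walks to the target. -/
structure IsTable (G : PathInstance) (K : ℕ) (nx : ℕ → ℕ → ℕ) (ds : ℕ → ℕ → ℝ) : Prop where
  zero_iff : ∀ v, nx 0 v ≠ 0 ↔ v = G.target
  zero_cost : ds 0 G.target = 0
  succ : ∀ k < K, IsNextRow G G.M (nx k) (ds k) (nx (k + 1)) (ds (k + 1))

/-- The walk with `k` edges from `v` described by the table. -/
def follow (G : PathInstance) (nx : ℕ → ℕ → ℕ) : ℕ → Fin G.N → List (Fin G.M)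
  | 0, _ => []
  | k + 1, v => if h : nx (k + 1) v - 1 < G.M then
      ⟨_, h⟩ :: G.follow nx k (G.head ⟨_, h⟩) else []

section Table

variable {K : ℕ} {nx : ℕ → ℕ → ℕ} {ds : ℕ → ℕ → ℝ}

/-- Bellman's inequality, by induction along the walk. Together with `IsTable.follow_spec` it
identifies `ds k v` as the minimum over walks, not necessarily simple, with exactly `k` edges. -/
theorem IsTable.le_walkCost (h : G.IsTable K nx ds) :
    ∀ (p : List (Fin G.M)) (u : Fin G.N), G.IsWalk u p G.target → p.length ≤ K →
      nx p.length u ≠ 0 ∧ ds p.length u ≤ G.walkCost p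
  | [], u, hp, _ => by
    obtain rfl : u = G.target := hp
    exact ⟨(h.zero_iff _).2 rfl, by simp [h.zero_cost]⟩
  | e :: p, u, hp, hk => by
    obtain ⟨rfl, hp⟩ := hp
    obtain ⟨h1, h2⟩ := h.le_walkCost p _ hp (by simp at hk; omega)
    obtain ⟨h3, h4⟩ := (h.succ p.length (by simpa using hk)).le_edge e e.2 h1
    exact ⟨h3, by simpa using h4.trans (by linarith)⟩

theorem IsTable.exists_edge (h : G.IsTable K nx ds) {k : ℕ} (hk : k < K) {v : Fin G.N}
    (hv : nx (k + 1) v ≠ 0) : ∃ e : Fin G.M, nx (k + 1) v = e + 1 ∧ G.tail e = v ∧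
      nx k (G.head e) ≠ 0 ∧ ds (k + 1) v = G.cost e + ds k (G.head e) ∧
      G.follow nx (k + 1) v = e :: G.follow nx k (G.head e) := by
  obtain ⟨e, -, h1, h2, h3, h4⟩ := (h.succ k hk).exists_edge v hv
  exact ⟨e, h1, Fin.ext h2, h3, h4, by simp [follow, h1]⟩

/-- Each nonzero entry names an edge whose head has a nonzero entry one row below, so the fallback
branch of `follow` is never taken here. -/
theorem IsTable.follow_spec (h : G.IsTable K nx ds) :
    ∀ (k : ℕ) (v : Fin G.N), k ≤ K → nx k v ≠ 0 →
      G.IsWalk v (G.follow nx k v) G.target ∧ (G.follow nx k v).length = k ∧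
        G.walkCost (G.follow nx k v) = ds k v
  | 0, v, _, hv => by
    obtain rfl : v = G.target := Fin.ext ((h.zero_iff _).1 hv)
    simp [follow, IsWalk, h.zero_cost]
  | k + 1, v, hk, hv => by
    obtain ⟨e, -, rfl, h3, h4, h5⟩ := h.exists_edge hk hv
    obtain ⟨h6, h7, h8⟩ := h.follow_spec k _ (by omega) h3
    rw [h5]
    exact ⟨⟨rfl, h6⟩, by simp [h7], by simp [h8, h4]⟩

end Table

end PathInstance

/-! ### Breakpoints of the lower envelope of lines -/

/-- Among the indices `j` with `r j`, the index `k < n` is, for some `lam ≥ 0`, the smallest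
minimizer of `d j + lam * j`. -/
def IsBreak (n : ℕ) (r : ℕ → Prop) (d : ℕ → ℝ) (k : ℕ) : Prop :=
  r k ∧ ∃ lam : ℝ, 0 ≤ lam ∧ (∀ j < n, k < j → r j → d k - d j ≤ lam * ((j : ℝ) - k)) ∧
    ∀ j < k, r j → lam * ((k : ℝ) - j) < d j - d k

section Break

variable {n : ℕ} {r : ℕ → Prop} {d : ℕ → ℝ}

theorem exists_isBreak (hr : ∃ k < n, r k) {lam : ℝ} (hl : 0 ≤ lam) :
    ∃ k < n, IsBreak n r d k ∧ ∀ j < n, r j → d k + lam * k ≤ d j + lam * j := by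
  classical
  let s := (Finset.range n).filter r
  have hs : s.Nonempty := by
    obtain ⟨k, hk⟩ := hr
    exact ⟨k, by simpa [s] using hk⟩
  obtain ⟨k₀, hk₀, hmin⟩ := s.exists_min_image (fun j => d j + lam * j) hs
  -- Ties are broken towards the smallest index, which yields the strict inequalities against
  -- smaller `j`.
  have hex : ∃ k, k ∈ s ∧ d k + lam * k ≤ d k₀ + lam * k₀ := ⟨k₀, hk₀, le_rfl⟩
  obtain ⟨h1, h2⟩ := Nat.find_spec hex
  have h3 := fun j hj => Nat.find_min hex (m := j) hj
  set k := Nat.find hex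
  simp only [s, Finset.mem_filter, Finset.mem_range] at h1 h3 hmin
  have hopt : ∀ j < n, r j → d k + lam * k ≤ d j + lam * j :=
    fun j hj hrj => h2.trans (hmin j ⟨hj, hrj⟩)
  refine ⟨k, h1.1, ⟨h1.2, lam, hl, fun j hj _ hrj => ?_, fun j hj hrj => ?_⟩, hopt⟩
  · linarith [hopt j hj hrj]
  · by_contra! hcon
    exact h3 j hj ⟨⟨hj.trans h1.1, hrj⟩, by linarith⟩

/-- Move `lam` slightly to the right. The finitely many strict inequalities against smaller indices
survive by continuity, and the weak ones against larger indices become strict because those lines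
are steeper. -/
theorem IsBreak.exists_unique_min {k : ℕ} (h : IsBreak n r d k) :
    ∃ lam : ℝ, 0 ≤ lam ∧ ∀ j < n, r j → j ≠ k → d k + lam * k < d j + lam * j := by
  obtain ⟨-, lam, hl, hgt, hlt⟩ := h
  have hev : ∀ᶠ x in nhdsWithin lam (Set.Ioi lam),
      ∀ j ∈ Set.Iio k, r j → x * ((k : ℝ) - j) < d j - d k := by
    rw [Filter.eventually_all_finite (Set.finite_Iio k)]
    intro j hj
    by_cases hrj : r j
    · have hc : Continuous fun x : ℝ => x * ((k : ℝ) - j) := by fun_prop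
      filter_upwards [nhdsWithin_le_nhds (hc.continuousAt.eventually_lt continuousAt_const
        (hlt j hj hrj))] with x hx _ using hx
    · exact .of_forall fun _ hj' => absurd hj' hrj
  obtain ⟨x, hx, hxl⟩ := (hev.and self_mem_nhdsWithin).exists
  have hxl : lam < x := hxl
  refine ⟨x, hl.trans hxl.le, fun j hj hrj hne => ?_⟩
  rcases lt_or_gt_of_ne hne with hjk | hjk
  · linarith [hx j hjk hrj]
  · have h1 := hgt j hj hjk hrj
    have h2 : (k : ℝ) < j := by exact_mod_cast hjk
    nlinarith

end Break

/-! ### Breakpoint walks form a smallest covering set -/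

namespace PathInstance

variable {G : PathInstance}

/-- The numbers of edges of the selected paths. -/
noncomputable def breaks (G : PathInstance) (nx : ℕ → ℕ → ℕ) (ds : ℕ → ℕ → ℝ) (m : ℕ) :
    List ℕ :=
  open Classical in
  (List.range m).filter fun k =>
    IsBreak G.N (fun j => nx j G.source ≠ 0) (fun j => ds j G.source) k

theorem mem_breaks {nx : ℕ → ℕ → ℕ} {ds : ℕ → ℕ → ℝ} {m k : ℕ} : k ∈ G.breaks nx ds m ↔
    k < m ∧ IsBreak G.N (fun j => nx j G.source ≠ 0) (fun j => ds j G.source) k := by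
  simp [breaks]

section Solution

variable {nx : ℕ → ℕ → ℕ} {ds : ℕ → ℕ → ℝ}

/-- A cycle could be removed, leaving a walk with `j < k` edges and no greater cost. But a
breakpoint has `0 ≤ lam * (k - j) < d j - d k`. -/
theorem IsTable.isPath_follow (hc : ∀ e, 0 ≤ G.cost e) (h : G.IsTable (G.N - 1) nx ds)
    {k : ℕ} (hk : k ∈ G.breaks nx ds G.N) : G.IsPath (G.follow nx k G.source) := by
  obtain ⟨hkN, hkr, lam, hl, -, hlt⟩ := mem_breaks.1 hk
  obtain ⟨h1, h2, h3⟩ := h.follow_spec k G.source (by omega) hkr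
  refine ⟨h1, (h1.nodup_or_shorter hc).resolve_right ?_⟩
  rintro ⟨q, hq, hlen, hcost⟩
  rw [h2] at hlen
  obtain ⟨h4, h5⟩ := h.le_walkCost q _ hq (by omega)
  have h6 := hlt _ hlen h4
  have h7 : (q.length : ℝ) ≤ k := by exact_mod_cast hlen.le
  have := mul_nonneg hl (sub_nonneg.2 h7)
  linarith

theorem IsTable.isSolution (hc : ∀ e, 0 ≤ G.cost e) (hp : ∃ p, G.IsPath p)
    (h : G.IsTable (G.N - 1) nx ds) {S : Set (Fin G.M → ℝ)}
    (hS : S = (fun k => G.incidence (G.follow nx k G.source)) '' {k | k ∈ G.breaks nx ds G.N}) :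
    ((G.breaks nx ds G.N).length : ℕ∞) = S.encard ∧
      IsSolution G.feasibleSet G.cost (constantGrowthBox (Fin G.M)) S ∧ S.encard ≤ G.N := by
  classical
  set L := G.breaks nx ds G.N with hL
  have hlen : ∀ k ∈ L, (G.follow nx k G.source).length = k := fun k hk =>
    (h.follow_spec k _ (by have := (mem_breaks.1 hk).1; omega) (mem_breaks.1 hk).2.1).2.1
  have hcost : ∀ k ∈ L, G.walkCost (G.follow nx k G.source) = ds k G.source := fun k hk =>
    (h.follow_spec k _ (by have := (mem_breaks.1 hk).1; omega) (mem_breaks.1 hk).2.1).2.2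
  have hpath : ∀ k ∈ L, G.IsPath (G.follow nx k G.source) := fun k hk => h.isPath_follow hc hk
  have hsum : ∀ k ∈ L, ∑ e, G.incidence (G.follow nx k G.source) e = k := fun k hk => by
    rw [sum_incidence (hpath k hk).nodup, hlen k hk]
  -- The coordinate sum of an incidence vector recovers the number of edges. The same map gives the
  -- lower bound on the size of covering sets.
  have hinj : Set.InjOn (fun k => G.incidence (G.follow nx k G.source)) {k | k ∈ L} := by
    intro k hk j hj hkj
    have := congrArg (fun x : Fin G.M → ℝ => ∑ e, x e) hkj
    simp only [hsum k hk, hsum j hj] at this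
    exact_mod_cast this
  have hnd : L.Nodup := List.nodup_range.filter _
  have hcard : S.encard = {k | k ∈ L}.encard := by rw [hS, hinj.encard_image]
  have hLcard : {k | k ∈ L}.encard = (L.length : ℕ∞) := by
    rw [← List.toFinset_card_of_nodup hnd, ← Set.encard_coe_eq_coe_finsetCard]
    congr 1
    ext; simp
  have hval : ∀ p, G.IsPath p → nx p.length G.source ≠ 0 ∧
      ds p.length G.source ≤ G.walkCost p := fun p hp =>
    h.le_walkCost p _ hp.1 (by have := hp.length_lt; omega)
  refine ⟨by rw [hcard, hLcard], ⟨⟨?_, ?_⟩, ?_⟩, ?_⟩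
  · rw [hS]
    rintro _ ⟨k, hk, rfl⟩
    exact ⟨_, hpath k hk, rfl⟩
  · intro lam hl
    obtain ⟨p₀, hp₀⟩ := hp
    obtain ⟨k, hkN, hk, hmin⟩ := exists_isBreak (n := G.N)
      (r := fun j => nx j G.source ≠ 0) (d := fun j => ds j G.source)
      ⟨_, hp₀.length_lt, (hval p₀ hp₀).1⟩ hl
    have hkL : k ∈ L := mem_breaks.2 ⟨hkN, hk⟩
    refine ⟨_, hS ▸ ⟨k, hkL, rfl⟩, ⟨_, hpath k hkL, rfl⟩, ?_⟩
    rintro _ ⟨p, hp, rfl⟩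
    rw [robustCost_incidence (hpath k hkL).nodup hl, robustCost_incidence hp.nodup hl,
      hlen k hkL, hcost k hkL]
    linarith [hmin _ hp.length_lt (hval p hp).1, (hval p hp).2]
  · intro S' hS'
    -- Where `k` is the unique minimizer, an optimal path with another number of edges would cost
    -- strictly more than the selected one.
    have hsub : (Nat.cast : ℕ → ℝ) '' {k | k ∈ L} ⊆ (fun x : Fin G.M → ℝ => ∑ e, x e) '' S' := by
      rintro _ ⟨k, hk, rfl⟩
      obtain ⟨lam, hl, hmin⟩ := (mem_breaks.1 hk).2.exists_unique_min
      obtain ⟨x, hx, ⟨p, hp, rfl⟩, hopt⟩ := hS'.2 lam hl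
      refine ⟨_, hx, ?_⟩
      have h1 := hopt _ ⟨_, hpath k hk, rfl⟩
      rw [robustCost_incidence (hpath k hk).nodup hl, robustCost_incidence hp.nodup hl,
        hlen k hk, hcost k hk] at h1
      have h2 : p.length = k := by
        by_contra hne
        have := hmin _ hp.length_lt (hval p hp).1 hne
        linarith [(hval p hp).2]
      simp only [sum_incidence hp.nodup, h2]
    calc S.encard = ((Nat.cast : ℕ → ℝ) '' {k | k ∈ L}).encard := by
          rw [hcard, Nat.cast_injective.encard_image]
      _ ≤ _ := (Set.encard_le_encard hsub).trans (Set.encard_image_le _ _)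
  · rw [hcard, hLcard]
    have : L.length ≤ G.N := by simpa [hL, breaks] using List.length_filter_le _ (List.range G.N)
    exact_mod_cast this

end Solution

end PathInstance

end VarRobust

namespace VarRobust

/-! ### Reasoning about runs of the machine -/

/-- Started in `σ`, the program `P` reaches within `T` steps a configuration with `Q`. -/
def Ends (P : List Instr) (σ : Config) (T : ℕ) (Q : Config → Prop) : Prop :=
  ∃ n ≤ T, ∃ τ, run P n σ = some τ ∧ Q τ

namespace Ends

variable {P : List Instr} {σ : Config} {T : ℕ} {Q : Config → Prop}

theorem done (h : Q σ) : Ends P σ T Q := ⟨0, Nat.zero_le _, σ, rfl, h⟩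

theorem of_step {τ : Config} (h : step P σ = some τ) (hτ : Ends P τ T Q) :
    Ends P σ (T + 1) Q := by
  obtain ⟨n, hn, υ, h1, h2⟩ := hτ
  exact ⟨n + 1, by omega, υ, by simp [run, h, h1], h2⟩

theorem mono {T' : ℕ} {Q' : Config → Prop} (h : Ends P σ T Q) (hT : T ≤ T')
    (hQ : ∀ τ, Q τ → Q' τ) : Ends P σ T' Q' := by
  obtain ⟨n, hn, τ, h1, h2⟩ := h
  exact ⟨n, hn.trans hT, τ, h1, hQ _ h2⟩

theorem run_add (m n : ℕ) (σ : Config) : run P (m + n) σ = (run P m σ).bind (run P n) := by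
  induction m generalizing σ with
  | zero => simp [run]
  | succ m ih =>
    rw [Nat.add_right_comm]
    simp only [run]
    cases step P σ with
    | none => rfl
    | some τ => simp [ih]

theorem trans {T' : ℕ} {Q' : Config → Prop} (h : Ends P σ T Q)
    (h' : ∀ τ, Q τ → Ends P τ T' Q') : Ends P σ (T + T') Q' := by
  obtain ⟨n, hn, τ, h1, h2⟩ := h
  obtain ⟨n', hn', τ', h1', h2'⟩ := h' τ h2
  exact ⟨n + n', by omega, τ', by simp [run_add, h1, h1'], h2'⟩

/-- The budget `T` bounds each round from above, so rounds may differ in length; a round that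
follows an early exit may take no step at all. -/
theorem loop {I : ℕ → Config → Prop} {a b : ℕ} (hab : a ≤ b)
    (h : ∀ i, a ≤ i → i < b → ∀ τ, I i τ → Ends P τ T (I (i + 1))) (h0 : I a σ) :
    Ends P σ ((b - a) * T) (I b) := by
  induction b, hab using Nat.le_induction with
  | base => exact done h0
  | succ b hab ih =>
    rw [Nat.sub_add_comm hab, Nat.add_mul, Nat.one_mul]
    exact (ih fun i h1 h2 => h i h1 (h2.trans b.lt_succ_self)).trans
      fun τ hτ => h b hab b.lt_succ_self τ hτ

variable {p a b c l k x : ℕ} {z y : ℝ} {kz : ℤ} {I A A' : ℕ → ℕ} {R B B' : ℕ → ℝ} {o : List ℕ}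

/-- This and the following rules execute one instruction symbolically. Their equational hypotheses
allow each computed value to be named in simplified form before execution continues. Division has no
rule because the program compares fractions by cross-multiplication. -/
theorem iconst (h : P[p]? = some (.iconst a k))
    (hτ : Ends P ⟨p + 1, Function.update I a k, R, A, B, o⟩ T Q) :
    Ends P ⟨p, I, R, A, B, o⟩ (T + 1) Q :=
  of_step (by simp [step, h, Instr.exec, Config.setI, Config.next]) hτ

theorem icopy (h : P[p]? = some (.icopy a b)) (hx : I b = x)
    (hτ : Ends P ⟨p + 1, Function.update I a x, R, A, B, o⟩ T Q) :
    Ends P ⟨p, I, R, A, B, o⟩ (T + 1) Q :=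
  of_step (by simp [step, h, Instr.exec, Config.setI, Config.next, hx]) hτ

theorem iadd (h : P[p]? = some (.iadd a b c)) (hx : I b + I c = x)
    (hτ : Ends P ⟨p + 1, Function.update I a x, R, A, B, o⟩ T Q) :
    Ends P ⟨p, I, R, A, B, o⟩ (T + 1) Q :=
  of_step (by simp [step, h, Instr.exec, Config.setI, Config.next, hx]) hτ

theorem isub (h : P[p]? = some (.isub a b c)) (hx : I b - I c = x)
    (hτ : Ends P ⟨p + 1, Function.update I a x, R, A, B, o⟩ T Q) :
    Ends P ⟨p, I, R, A, B, o⟩ (T + 1) Q :=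
  of_step (by simp [step, h, Instr.exec, Config.setI, Config.next, hx]) hτ

theorem iload (h : P[p]? = some (.iload a b)) (hx : A (I b) = x)
    (hτ : Ends P ⟨p + 1, Function.update I a x, R, A, B, o⟩ T Q) :
    Ends P ⟨p, I, R, A, B, o⟩ (T + 1) Q :=
  of_step (by simp [step, h, Instr.exec, Config.setI, Config.next, hx]) hτ

theorem istore (h : P[p]? = some (.istore a b)) (hx : Function.update A (I a) (I b) = A')
    (hτ : Ends P ⟨p + 1, I, R, A', B, o⟩ T Q) :
    Ends P ⟨p, I, R, A, B, o⟩ (T + 1) Q :=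
  of_step (by simp [step, h, Instr.exec, hx]) hτ

theorem rconst (h : P[p]? = some (.rconst a kz)) (hz : (kz : ℝ) = z)
    (hτ : Ends P ⟨p + 1, I, Function.update R a z, A, B, o⟩ T Q) :
    Ends P ⟨p, I, R, A, B, o⟩ (T + 1) Q :=
  of_step (by simp [step, h, Instr.exec, Config.setR, Config.next, hz]) hτ

theorem rcopy (h : P[p]? = some (.rcopy a b)) (hz : R b = z)
    (hτ : Ends P ⟨p + 1, I, Function.update R a z, A, B, o⟩ T Q) :
    Ends P ⟨p, I, R, A, B, o⟩ (T + 1) Q :=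
  of_step (by simp [step, h, Instr.exec, Config.setR, Config.next, hz]) hτ

theorem radd (h : P[p]? = some (.radd a b c)) (hz : R b + R c = z)
    (hτ : Ends P ⟨p + 1, I, Function.update R a z, A, B, o⟩ T Q) :
    Ends P ⟨p, I, R, A, B, o⟩ (T + 1) Q :=
  of_step (by simp [step, h, Instr.exec, Config.setR, Config.next, hz]) hτ

theorem rsub (h : P[p]? = some (.rsub a b c)) (hz : R b - R c = z)
    (hτ : Ends P ⟨p + 1, I, Function.update R a z, A, B, o⟩ T Q) :
    Ends P ⟨p, I, R, A, B, o⟩ (T + 1) Q :=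
  of_step (by simp [step, h, Instr.exec, Config.setR, Config.next, hz]) hτ

theorem rmul (h : P[p]? = some (.rmul a b c)) (hz : R b * R c = z)
    (hτ : Ends P ⟨p + 1, I, Function.update R a z, A, B, o⟩ T Q) :
    Ends P ⟨p, I, R, A, B, o⟩ (T + 1) Q :=
  of_step (by simp [step, h, Instr.exec, Config.setR, Config.next, hz]) hτ

theorem rload (h : P[p]? = some (.rload a b)) (hz : B (I b) = z)
    (hτ : Ends P ⟨p + 1, I, Function.update R a z, A, B, o⟩ T Q) :
    Ends P ⟨p, I, R, A, B, o⟩ (T + 1) Q :=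
  of_step (by simp [step, h, Instr.exec, Config.setR, Config.next, hz]) hτ

theorem rstore (h : P[p]? = some (.rstore a b)) (hx : Function.update B (I a) (R b) = B')
    (hτ : Ends P ⟨p + 1, I, R, A, B', o⟩ T Q) :
    Ends P ⟨p, I, R, A, B, o⟩ (T + 1) Q :=
  of_step (by simp [step, h, Instr.exec, hx]) hτ

theorem ijump (h : P[p]? = some (.ijumple a b l)) (hx : I a ≤ I b)
    (hτ : Ends P ⟨l, I, R, A, B, o⟩ T Q) : Ends P ⟨p, I, R, A, B, o⟩ (T + 1) Q :=
  of_step (by simp [step, h, Instr.exec, hx]) hτ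

theorem iskip (h : P[p]? = some (.ijumple a b l)) (hx : I b < I a)
    (hτ : Ends P ⟨p + 1, I, R, A, B, o⟩ T Q) : Ends P ⟨p, I, R, A, B, o⟩ (T + 1) Q :=
  of_step (by simp [step, h, Instr.exec, Config.next, hx]) hτ

theorem rjump (h : P[p]? = some (.rjumple a b l)) (hx : R a ≤ R b)
    (hτ : Ends P ⟨l, I, R, A, B, o⟩ T Q) : Ends P ⟨p, I, R, A, B, o⟩ (T + 1) Q :=
  of_step (by simp [step, h, Instr.exec, hx]) hτ

theorem rskip (h : P[p]? = some (.rjumple a b l)) (hx : R b < R a)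
    (hτ : Ends P ⟨p + 1, I, R, A, B, o⟩ T Q) : Ends P ⟨p, I, R, A, B, o⟩ (T + 1) Q :=
  of_step (by simp [step, h, Instr.exec, Config.next, hx]) hτ

theorem output (h : P[p]? = some (.output a)) (hx : I a = x)
    (hτ : Ends P ⟨p + 1, I, R, A, B, o ++ [x]⟩ T Q) : Ends P ⟨p, I, R, A, B, o⟩ (T + 1) Q :=
  of_step (by simp [step, h, Instr.exec, hx]) hτ

end Ends

/-! ### The memory layout -/

namespace PathInstance

variable {G : PathInstance}

/-- The `i`-memory: the edges, followed by the rows of the table `nx`. -/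
noncomputable def imemOf (G : PathInstance) (nx : ℕ → ℕ → ℕ) (a : ℕ) : ℕ :=
  if a < 2 * G.M then G.initConfig.imem a
  else nx ((a - 2 * G.M) / G.N) ((a - 2 * G.M) % G.N)

/-- The `r`-memory: the costs, followed by the rows of the table `ds`. -/
noncomputable def rmemOf (G : PathInstance) (ds : ℕ → ℕ → ℝ) (a : ℕ) : ℝ :=
  if a < G.M then G.initConfig.rmem a else ds ((a - G.M) / G.N) ((a - G.M) % G.N)

/-- Cells beyond the input are zero, and zero means unreachable, so no initialization pass is
needed. -/
theorem initConfig_imem : G.initConfig.imem = G.imemOf 0 := by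
  ext a
  simp only [imemOf]
  split_ifs with h
  · rfl
  · have : ¬ a / 2 < G.M := by omega
    simp [initConfig, this]

theorem initConfig_rmem : G.initConfig.rmem = G.rmemOf 0 := by
  ext a
  simp only [rmemOf]
  split_ifs with h
  · rfl
  · simp [initConfig, h]

theorem imemOf_tail (nx : ℕ → ℕ → ℕ) (e : Fin G.M) : G.imemOf nx (2 * e) = G.tail e := by
  have := e.2
  simp [imemOf, initConfig]

theorem imemOf_head (nx : ℕ → ℕ → ℕ) (e : Fin G.M) : G.imemOf nx (2 * e + 1) = G.head e := by
  have := e.2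
  have h1 : 2 * (e : ℕ) + 1 < 2 * G.M := by omega
  have h2 : (2 * (e : ℕ) + 1) / 2 = e := by omega
  simp [imemOf, initConfig, h1, h2, Nat.add_mod]

theorem rmemOf_cost (ds : ℕ → ℕ → ℝ) (e : Fin G.M) : G.rmemOf ds e = G.cost e := by
  simp [rmemOf, initConfig]

theorem div_mod_row {n k v : ℕ} (hv : v < n) :
    (k * n + v) / n = k ∧ (k * n + v) % n = v := by
  have hn : 0 < n := by omega
  constructor
  · rw [mul_comm, Nat.mul_add_div hn, Nat.div_eq_of_lt hv, add_zero]
  · rw [mul_comm, Nat.mul_add_mod, Nat.mod_eq_of_lt hv]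

theorem imemOf_table (nx : ℕ → ℕ → ℕ) (k : ℕ) {v : ℕ} (hv : v < G.N) :
    G.imemOf nx (2 * G.M + k * G.N + v) = nx k v := by
  have h : 2 * G.M + k * G.N + v - 2 * G.M = k * G.N + v := by omega
  simp [imemOf, h, div_mod_row hv, show ¬ 2 * G.M + k * G.N + v < 2 * G.M by omega]

theorem rmemOf_table (ds : ℕ → ℕ → ℝ) (k : ℕ) {v : ℕ} (hv : v < G.N) :
    G.rmemOf ds (G.M + k * G.N + v) = ds k v := by
  have h : G.M + k * G.N + v - G.M = k * G.N + v := by omega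
  simp [rmemOf, h, div_mod_row hv, show ¬ G.M + k * G.N + v < G.M by omega]

/-- The table `f` with the entry in row `k` and column `v` replaced by `x`. -/
def setEntry {α : Type*} (f : ℕ → ℕ → α) (k v : ℕ) (x : α) : ℕ → ℕ → α :=
  Function.update f k (Function.update (f k) v x)

theorem setEntry_self {α : Type*} (f : ℕ → ℕ → α) (k v : ℕ) (x : α) :
    setEntry f k v x k = Function.update (f k) v x := by simp [setEntry]

theorem setEntry_of_ne {α : Type*} (f : ℕ → ℕ → α) {j k : ℕ} (v : ℕ) (x : α) (h : j ≠ k) :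
    setEntry f k v x j = f j := by simp [setEntry, h]

/-- For `v < n`, quotient and remainder recover row and column from the address, so one memory write
changes exactly one table entry. Both memories use this, with different offsets `c`. -/
theorem update_row {α : Type*} (f : ℕ → ℕ → α) (k v n c : ℕ) (hv : v < n) (x : α)
    (g : ℕ → α) :
    Function.update (fun a => if a < c then g a else f ((a - c) / n) ((a - c) % n))
      (c + k * n + v) x =
      fun a => if a < c then g a else setEntry f k v x ((a - c) / n) ((a - c) % n) := by
  ext a
  by_cases ha : a = c + k * n + v
  · subst ha
    have h : c + k * n + v - c = k * n + v := by omega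
    simp [h, div_mod_row hv, setEntry, show ¬ c + k * n + v < c by omega]
  · rw [Function.update_of_ne ha]
    split_ifs with hc
    · rfl
    · by_cases hk : (a - c) / n = k
      · have hm : (a - c) % n ≠ v := by
          rintro rfl
          have := Nat.div_add_mod' (a - c) n
          rw [hk] at this
          omega
        rw [hk, setEntry_self, Function.update_of_ne hm]
      · rw [setEntry_of_ne _ _ _ hk]

theorem update_imemOf (nx : ℕ → ℕ → ℕ) (k : ℕ) {v : ℕ} (hv : v < G.N) (x : ℕ) :
    Function.update (G.imemOf nx) (2 * G.M + k * G.N + v) x = G.imemOf (setEntry nx k v x) :=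
  update_row nx k v G.N (2 * G.M) hv x G.initConfig.imem

theorem update_rmemOf (ds : ℕ → ℕ → ℝ) (k : ℕ) {v : ℕ} (hv : v < G.N) (x : ℝ) :
    Function.update (G.rmemOf ds) (G.M + k * G.N + v) x = G.rmemOf (setEntry ds k v x) :=
  update_row ds k v G.N G.M hv x G.initConfig.rmem

end PathInstance

end VarRobust

namespace VarRobust

/-! ### The program -/

/-- The program: first the table of shortest walks to the target with `0, …, N - 1` edges, row by
row (from position 8), then the selection of the numbers of edges that are breakpoints of
the lower envelope, marked in row `N` of the table (from position 46), then the output (from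
position 99). -/
def program : List Instr := [
  .iconst 4 1, .iadd 6 1 1, .iadd 16 6 3, .istore 16 4, .icopy 8 1, .iadd 9 6 0,
  .iadd 10 8 0, .icopy 11 4,
  .ijumple 0 11 39, .iconst 12 0, .iconst 13 0,
  .ijumple 1 12 33, .iload 14 13, .iadd 13 13 4, .iload 15 13, .iadd 13 13 4, .iadd 16 6 15,
  .iload 17 16, .iadd 16 8 15, .rload 1 16, .rload 2 12, .radd 1 2 1, .iadd 16 9 14,
  .iadd 18 10 14, .iadd 12 12 4, .ijumple 17 5 11, .iload 17 16, .ijumple 17 5 30,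
  .rload 2 18, .rjumple 2 1 11,
  .istore 16 12, .rstore 18 1, .ijumple 5 5 11,
  .icopy 6 9, .icopy 8 10, .iadd 9 9 0, .iadd 10 10 0, .iadd 11 11 4, .ijumple 5 5 8,
  .iconst 11 0, .iconst 19 0, .iadd 6 1 1, .iadd 6 6 2, .iadd 8 1 2, .rconst 3 1,
  .rconst 10 0,
  .ijumple 0 11 99, .iload 17 6, .ijumple 17 5 94, .rload 1 8, .rconst 4 0, .rconst 5 1,
  .iadd 12 11 4, .iadd 13 6 0, .iadd 14 8 0, .rcopy 6 3,
  .ijumple 0 12 72, .iload 17 13, .rload 2 14, .iadd 12 12 4, .iadd 13 13 0, .iadd 14 14 0,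
  .rcopy 9 6, .radd 6 6 3, .ijumple 17 5 56, .rsub 2 1 2, .rmul 7 2 5, .rmul 8 4 9,
  .rjumple 7 8 56, .rcopy 4 2, .rcopy 5 9, .ijumple 5 5 56,
  .iconst 12 0, .iadd 13 1 1, .iadd 13 13 2, .iadd 14 1 2, .rcopy 6 10,
  .ijumple 11 12 91, .iload 17 13, .rload 2 14, .iadd 12 12 4, .iadd 13 13 0, .iadd 14 14 0,
  .rcopy 9 6, .rsub 6 6 3, .ijumple 17 5 77, .rsub 2 2 1, .rmul 7 2 5, .rmul 8 4 9,
  .rjumple 7 8 94, .ijumple 5 5 77,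
  .iadd 16 9 11, .istore 16 4, .iadd 19 19 4,
  .iadd 11 11 4, .iadd 6 6 0, .iadd 8 8 0, .radd 10 10 3, .ijumple 5 5 46,
  .output 19, .iconst 11 0, .iadd 6 1 1,
  .ijumple 0 11 124, .iadd 16 9 11, .iload 17 16, .ijumple 17 5 121, .output 11,
  .icopy 12 11, .icopy 13 6, .icopy 14 2,
  .ijumple 12 5 121, .iadd 16 13 14, .iload 17 16, .isub 17 17 4, .output 17, .iadd 16 17 17,
  .iadd 16 16 4, .iload 14 16, .isub 12 12 4, .isub 13 13 0, .ijumple 5 5 110,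
  .iadd 11 11 4, .iadd 6 6 0, .ijumple 5 5 102,
  .halt]

namespace PathInstance

variable {G : PathInstance}

/-- The registers that do not change after the first instruction. -/
structure Consts (G : PathInstance) (I : ℕ → ℕ) : Prop where
  nodes : I 0 = G.N
  edges : I 1 = G.M
  source : I 2 = G.source
  target : I 3 = G.target
  one : I 4 = 1
  zero : I 5 = 0

/-! ### The table of shortest walks -/

/-- The rows `0, …, k` of the table are complete, the row `k + 1` takes the first `m` edges into
account, and all later rows are zero. -/
structure IsPartialTable (G : PathInstance) (k m : ℕ) (nx : ℕ → ℕ → ℕ) (ds : ℕ → ℕ → ℝ) :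
    Prop where
  table : G.IsTable k nx ds
  row : IsNextRow G m (nx k) (ds k) (nx (k + 1)) (ds (k + 1))
  zero : ∀ j, k + 1 < j → nx j = 0

section Partial

variable {k m : ℕ} {nx : ℕ → ℕ → ℕ} {ds : ℕ → ℕ → ℝ}

theorem IsTable.congr {nx' : ℕ → ℕ → ℕ} {ds' : ℕ → ℕ → ℝ} (h : G.IsTable k nx ds)
    (hn : ∀ j ≤ k, nx' j = nx j) (hd : ∀ j ≤ k, ds' j = ds j) : G.IsTable k nx' ds' where
  zero_iff := by rw [hn 0 k.zero_le]; exact h.zero_iff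
  zero_cost := by rw [hd 0 k.zero_le]; exact h.zero_cost
  succ j hj := by
    rw [hn j hj.le, hn (j + 1) hj, hd j hj.le, hd (j + 1) hj]
    exact h.succ j hj

/-- In row `0` the value `1` is only a nonzero mark for the target, not an edge. -/
theorem isPartialTable_zero :
    G.IsPartialTable 0 0 (setEntry 0 0 G.target 1) 0 where
  table :=
    { zero_iff := fun v => by
        rw [setEntry_self, Function.update_apply]
        split_ifs with h <;> simp [h]
      zero_cost := rfl
      succ := by simp }
  row :=
    { exists_edge := fun v hv => by simp [setEntry] at hv
      le_edge := by simp }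
  zero j hj := by rw [setEntry_of_ne _ _ _ (by omega)]; rfl

theorem IsPartialTable.next_row (h : G.IsPartialTable k G.M nx ds) :
    G.IsPartialTable (k + 1) 0 nx ds where
  table :=
    { zero_iff := h.table.zero_iff
      zero_cost := h.table.zero_cost
      succ := fun j hj => by
        rcases Nat.lt_succ_iff_lt_or_eq.1 hj with hj | rfl
        · exact h.table.succ j hj
        · exact h.row }
  row :=
    { exists_edge := fun v hv => by simp [h.zero (k + 1 + 1) (by omega)] at hv
      le_edge := by simp }
  zero j hj := h.zero j (by omega)

theorem IsPartialTable.skip {e : Fin G.M} (h : G.IsPartialTable k e nx ds)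
    (he : nx k (G.head e) ≠ 0 → nx (k + 1) (G.tail e) ≠ 0 ∧
      ds (k + 1) (G.tail e) ≤ G.cost e + ds k (G.head e)) :
    G.IsPartialTable k (e + 1) nx ds where
  table := h.table
  row :=
    { exists_edge := fun v hv => by
        obtain ⟨e', h1, h2⟩ := h.row.exists_edge v hv
        exact ⟨e', h1.trans (Nat.lt_succ_self _), h2⟩
      le_edge := fun e' he' h' => by
        rcases Nat.lt_succ_iff_lt_or_eq.1 he' with he' | he'
        · exact h.row.le_edge e' he' h'
        · obtain rfl := Fin.ext he'
          exact he h' }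
  zero := h.zero

/-- Only row `k + 1` is written, so relaxation always reads a finished row. Earlier edges with the
same tail keep their inequality because the new value is at most the old one. -/
theorem IsPartialTable.improve {e : Fin G.M} (h : G.IsPartialTable k e nx ds)
    (h0 : nx k (G.head e) ≠ 0) (he : nx (k + 1) (G.tail e) ≠ 0 →
      G.cost e + ds k (G.head e) ≤ ds (k + 1) (G.tail e)) :
    G.IsPartialTable k (e + 1) (setEntry nx (k + 1) (G.tail e) (e + 1))
      (setEntry ds (k + 1) (G.tail e) (G.cost e + ds k (G.head e))) where
  table := h.table.congr (fun j hj => setEntry_of_ne _ _ _ (by omega))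
    (fun j hj => setEntry_of_ne _ _ _ (by omega))
  row := by
    rw [setEntry_self, setEntry_self, setEntry_of_ne _ _ _ (by omega : k ≠ k + 1),
      setEntry_of_ne _ _ _ (by omega : k ≠ k + 1)]
    constructor
    · intro v hv
      by_cases hve : v = G.tail e
      · subst hve
        exact ⟨e, by simp, by simp, rfl, h0, by simp⟩
      · rw [Function.update_of_ne hve] at hv ⊢
        rw [Function.update_of_ne hve]
        obtain ⟨e', h1, h2⟩ := h.row.exists_edge v hv
        exact ⟨e', h1.trans (Nat.lt_succ_self _), h2⟩
    · intro e' he' h'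
      by_cases hve : (G.tail e' : ℕ) = G.tail e
      · rw [hve, Function.update_self, Function.update_self]
        refine ⟨by omega, ?_⟩
        rcases Nat.lt_succ_iff_lt_or_eq.1 he' with he' | he'
        · have := h.row.le_edge e' he' h'
          rw [hve] at this
          exact (he this.1).trans this.2
        · obtain rfl := Fin.ext he'
          exact le_rfl
      · rw [Function.update_of_ne hve, Function.update_of_ne hve]
        rcases Nat.lt_succ_iff_lt_or_eq.1 he' with he' | he'
        · exact h.row.le_edge e' he' h'
        · exact absurd (by rw [Fin.ext he']) hve
  zero j hj := by
    rw [setEntry_of_ne _ _ _ (by omega)]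
    exact h.zero j hj

end Partial

/-- The registers while row `k + 1` of the table is computed. -/
structure RowRegs (G : PathInstance) (k : ℕ) (I : ℕ → ℕ) : Prop extends Consts G I where
  irow : I 6 = 2 * G.M + k * G.N
  rrow : I 8 = G.M + k * G.N
  inext : I 9 = 2 * G.M + (k + 1) * G.N
  rnext : I 10 = G.M + (k + 1) * G.N
  index : I 11 = k + 1

/-- The configurations at the head of the loop over the edges. -/
def EdgeLoop (G : PathInstance) (k m : ℕ) (σ : Config) : Prop :=
  ∃ I R nx ds, σ = ⟨11, I, R, G.imemOf nx, G.rmemOf ds, []⟩ ∧ RowRegs G k I ∧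
    I 12 = m ∧ I 13 = 2 * m ∧ G.IsPartialTable k m nx ds

theorem edgeLoop_store {k : ℕ} {e : Fin G.M} {I : ℕ → ℕ} {R : ℕ → ℝ} {nx : ℕ → ℕ → ℕ}
    {ds : ℕ → ℕ → ℝ} (hI : RowRegs G k I) (i12 : I 12 = e + 1) (i13 : I 13 = 2 * (e + 1))
    (i16 : I 16 = 2 * G.M + (k + 1) * G.N + G.tail e)
    (i18 : I 18 = G.M + (k + 1) * G.N + G.tail e) (r1 : R 1 = G.cost e + ds k (G.head e))
    (hT : G.IsPartialTable k e nx ds) (h0 : nx k (G.head e) ≠ 0)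
    (he : nx (k + 1) (G.tail e) ≠ 0 → G.cost e + ds k (G.head e) ≤ ds (k + 1) (G.tail e)) :
    Ends program ⟨30, I, R, G.imemOf nx, G.rmemOf ds, []⟩ 3 (EdgeLoop G k (e + 1)) := by
  have hA := update_imemOf nx (k + 1) (G.tail e).2 (e + 1)
  have hB := update_rmemOf ds (k + 1) (G.tail e).2 (G.cost e + ds k (G.head e))
  rw [← i16, ← i12] at hA
  rw [← i18, ← r1] at hB
  refine .istore rfl hA (.rstore rfl hB ?_)
  refine .ijump rfl le_rfl (.done ?_)
  rw [i12, r1]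
  exact ⟨I, R, _, _, rfl, hI, i12, i13, hT.improve h0 he⟩

theorem edgeLoop_step {k m : ℕ} (hm : m < G.M) {σ : Config} (hσ : EdgeLoop G k m σ) :
    Ends program σ 22 (EdgeLoop G k (m + 1)) := by
  obtain ⟨I, R, nx, ds, rfl, ⟨⟨c0, c1, c2, c3, c4, c5⟩, i6, i8, i9, i10, i11⟩, i12, i13, hT⟩ := hσ
  obtain ⟨e, rfl⟩ : ∃ e : Fin G.M, (e : ℕ) = m := ⟨⟨m, hm⟩, rfl⟩
  refine .iskip rfl (by simp [*]) ?_
  refine .iload (x := G.tail e) rfl (by simp [*, imemOf_tail]) ?_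
  refine .iadd (x := 2 * e + 1) rfl (by simp [*]) ?_
  refine .iload (x := G.head e) rfl (by simp [imemOf_head]) ?_
  refine .iadd (x := 2 * e + 2) rfl (by simp [*]) ?_
  refine .iadd (x := 2 * G.M + k * G.N + G.head e) rfl (by simp [*]) ?_
  refine .iload (x := nx k (G.head e)) rfl (by simp [imemOf_table]) ?_
  refine .iadd (x := G.M + k * G.N + G.head e) rfl (by simp [*]) ?_
  refine .rload (z := ds k (G.head e)) rfl (by simp [rmemOf_table]) ?_
  refine .rload (z := G.cost e) rfl (by simp [*, rmemOf_cost]) ?_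
  refine .radd (z := G.cost e + ds k (G.head e)) rfl (by simp) ?_
  refine .iadd (x := 2 * G.M + (k + 1) * G.N + G.tail e) rfl (by simp [*]) ?_
  refine .iadd (x := G.M + (k + 1) * G.N + G.tail e) rfl (by simp [*]) ?_
  -- The advanced loop counter doubles as the shifted edge index to be stored.
  refine .iadd (x := e + 1) rfl (by simp [*]) ?_
  by_cases h0 : nx k (G.head e) = 0
  · refine .ijump rfl (by simp [*]) (.done ?_)
    exact ⟨_, _, nx, ds, rfl, ⟨⟨by simpa, by simpa, by simpa, by simpa, by simpa, by simpa⟩,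
      by simpa, by simpa, by simpa, by simpa, by simpa⟩, by simp, by simp; ring,
      hT.skip fun h => absurd h0 h⟩
  refine .iskip rfl (by simp [*]; omega) ?_
  refine .iload (x := nx (k + 1) (G.tail e)) rfl (by simp [imemOf_table]) ?_
  by_cases h1 : nx (k + 1) (G.tail e) = 0
  · refine .ijump rfl (by simp [*]) (.mono (edgeLoop_store (hT := hT) (h0 := h0)
      ⟨⟨by simpa, by simpa, by simpa, by simpa, by simpa, by simpa⟩,
        by simpa, by simpa, by simpa, by simpa, by simpa⟩
      (by simp) (by simp; ring) (by simp) (by simp) (by simp) (absurd h1))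
      (by omega) fun _ h => h)
  refine .iskip rfl (by simp [*]; omega) ?_
  refine .rload (z := ds (k + 1) (G.tail e)) rfl (by simp [rmemOf_table]) ?_
  by_cases h2 : ds (k + 1) (G.tail e) ≤ G.cost e + ds k (G.head e)
  · refine .rjump rfl (by simpa) (.done ?_)
    exact ⟨_, _, nx, ds, rfl, ⟨⟨by simpa, by simpa, by simpa, by simpa, by simpa, by simpa⟩,
      by simpa, by simpa, by simpa, by simpa, by simpa⟩, by simp, by simp; ring,
      hT.skip fun _ => ⟨h1, h2⟩⟩
  · exact .rskip rfl (by simpa using h2) (edgeLoop_store (hT := hT) (h0 := h0)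
      ⟨⟨by simpa, by simpa, by simpa, by simpa, by simpa, by simpa⟩,
        by simpa, by simpa, by simpa, by simpa, by simpa⟩
      (by simp) (by simp; ring) (by simp) (by simp) (by simp) fun _ => (not_le.1 h2).le)

/-- The configurations at the head of the loop over the rows. -/
def RowLoop (G : PathInstance) (k : ℕ) (σ : Config) : Prop :=
  ∃ I R nx ds, σ = ⟨8, I, R, G.imemOf nx, G.rmemOf ds, []⟩ ∧ RowRegs G k I ∧
    G.IsPartialTable k 0 nx ds

theorem rowLoop_init : Ends program G.initConfig 8 (RowLoop G 0) := by
  rw [show G.initConfig = ⟨0, G.initConfig.ireg, G.initConfig.rreg, G.imemOf 0, G.rmemOf 0, []⟩ by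
    rw [← initConfig_imem, ← initConfig_rmem]; rfl]
  have c0 : G.initConfig.ireg 0 = G.N := by simp [initConfig]
  have c1 : G.initConfig.ireg 1 = G.M := by simp [initConfig]
  have c2 : G.initConfig.ireg 2 = G.source := by simp [initConfig]
  have c3 : G.initConfig.ireg 3 = G.target := by simp [initConfig]
  have c5 : G.initConfig.ireg 5 = 0 := by simp [initConfig]
  generalize G.initConfig.ireg = I at *
  refine .iconst rfl ?_
  refine .iadd (x := 2 * G.M) rfl (by simp [*]; ring) ?_
  refine .iadd (x := 2 * G.M + 0 * G.N + G.target) rfl (by simp [*]) ?_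
  refine .istore (A' := G.imemOf (setEntry 0 0 G.target 1)) rfl
    (by simpa using update_imemOf 0 0 G.target.2 1) ?_
  refine .icopy (x := G.M) rfl (by simp [*]) ?_
  refine .iadd (x := 2 * G.M + G.N) rfl (by simp [*]) ?_
  refine .iadd (x := G.M + G.N) rfl (by simp [*]) ?_
  refine .icopy (x := 1) rfl (by simp [*]) (.done ?_)
  exact ⟨_, _, _, _, rfl, ⟨⟨by simpa, by simpa, by simpa, by simpa, by simp, by simpa⟩,
    by simp, by simp, by simp, by simp, by simp⟩, isPartialTable_zero⟩

theorem rowLoop_step {k : ℕ} (hk : k + 1 < G.N) {σ : Config} (hσ : RowLoop G k σ) :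
    Ends program σ (3 + (G.M * 22 + 7)) (RowLoop G (k + 1)) := by
  refine Ends.trans (Q := EdgeLoop G k 0) ?_ fun τ hτ =>
    (Ends.loop (I := EdgeLoop G k) G.M.zero_le
      (fun m _ hm υ hυ => edgeLoop_step hm hυ) hτ).trans ?_
  · obtain ⟨I, R, nx, ds, rfl, ⟨⟨c0, c1, c2, c3, c4, c5⟩, i6, i8, i9, i10, i11⟩, hT⟩ := hσ
    refine .iskip rfl (by simp [*]) (.iconst rfl (.iconst rfl (.done ?_)))
    exact ⟨_, _, nx, ds, rfl, ⟨⟨by simpa, by simpa, by simpa, by simpa, by simpa, by simpa⟩,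
      by simpa, by simpa, by simpa, by simpa, by simpa⟩, by simp, by simp, hT⟩
  · rintro _ ⟨I, R, nx, ds, rfl, ⟨⟨c0, c1, c2, c3, c4, c5⟩, i6, i8, i9, i10, i11⟩, i12, i13, hT⟩
    refine .ijump rfl (by simp [*]) ?_
    refine .icopy (x := 2 * G.M + (k + 1) * G.N) rfl (by simp [*]) ?_
    refine .icopy (x := G.M + (k + 1) * G.N) rfl (by simp [*]) ?_
    refine .iadd (x := 2 * G.M + (k + 1 + 1) * G.N) rfl (by simp [*]; ring) ?_
    refine .iadd (x := G.M + (k + 1 + 1) * G.N) rfl (by simp [*]; ring) ?_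
    refine .iadd (x := k + 1 + 1) rfl (by simp [*]) ?_
    refine .ijump rfl le_rfl (.done ?_)
    exact ⟨_, _, nx, ds, rfl, ⟨⟨by simpa, by simpa, by simpa, by simpa, by simpa, by simpa⟩,
      by simp, by simp, by simp, by simp, by simp⟩, hT.next_row⟩

/-- The situation after the first phase. -/
def TableDone (G : PathInstance) (σ : Config) : Prop :=
  ∃ I R nx ds, σ = ⟨39, I, R, G.imemOf nx, G.rmemOf ds, []⟩ ∧ Consts G I ∧
    I 9 = 2 * G.M + G.N * G.N ∧ G.IsTable (G.N - 1) nx ds ∧ nx G.N = 0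

theorem tableDone :
    Ends program G.initConfig (8 + (G.N * (3 + (G.M * 22 + 7)) + 1)) (TableDone G) := by
  have hN : 0 < G.N := G.source.pos
  refine rowLoop_init.trans fun τ hτ => Ends.trans
    ((Ends.loop (I := RowLoop G) (G.N - 1).zero_le
      (fun k _ hk υ hυ => rowLoop_step (by omega) hυ) hτ).mono
        (Nat.mul_le_mul_right _ (by omega)) fun _ h => h) ?_
  rintro _ ⟨I, R, nx, ds, rfl, ⟨hc, i6, i8, i9, i10, i11⟩, hT⟩
  have h1 : G.N - 1 + 1 = G.N := by omega
  rw [h1] at i9 i11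
  -- Row `N` has seen no edge, so it is still zero and can later hold the breakpoint marks.
  have hz : nx G.N = 0 := by
    rw [← h1]
    ext v
    by_contra hv
    obtain ⟨e, he, -⟩ := hT.row.exists_edge v hv
    exact absurd he (Nat.not_lt_zero _)
  exact .ijump rfl (by simp [i11, hc.nodes]) (.done ⟨I, R, nx, ds, rfl, hc, i9, hT.table, hz⟩)

end PathInstance

end VarRobust

namespace VarRobust

/-! ### The selection of the breakpoints -/

/-- The fraction `num / den` is the largest of `0` and the slopes `(d k - d j) / (j - k)` for
the indices `j` with `k < j < m` and `r j`. -/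
structure IsThreshold (r : ℕ → Prop) (d : ℕ → ℝ) (k m : ℕ) (num den : ℝ) : Prop where
  den_pos : 0 < den
  num_nonneg : 0 ≤ num
  le : ∀ j < m, k < j → r j → (d k - d j) * den ≤ num * ((j : ℝ) - k)
  attained : num = 0 ∨ ∃ j < m, k < j ∧ r j ∧ num = d k - d j ∧ den = (j : ℝ) - k

namespace IsThreshold

variable {r : ℕ → Prop} {d : ℕ → ℝ} {k m n : ℕ} {num den : ℝ}

theorem init (r : ℕ → Prop) (d : ℕ → ℝ) (k : ℕ) : IsThreshold r d k (k + 1) 0 1 :=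
  ⟨one_pos, le_rfl, fun j h1 h2 => by omega, .inl rfl⟩

theorem skip (h : IsThreshold r d k m num den)
    (hm : r m → (d k - d m) * den ≤ num * ((m : ℝ) - k)) :
    IsThreshold r d k (m + 1) num den where
  den_pos := h.den_pos
  num_nonneg := h.num_nonneg
  le j hj hkj hr := by
    rcases Nat.lt_succ_iff_lt_or_eq.1 hj with hj | rfl
    · exact h.le j hj hkj hr
    · exact hm hr
  attained := h.attained.imp_right fun ⟨j, hj, h'⟩ => ⟨j, hj.trans m.lt_succ_self, h'⟩

/-- The new slope exceeds the old maximum, hence is positive and dominates all earlier slopes;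
transitivity of the fractions is obtained by cancelling the positive `den`. -/
theorem replace (h : IsThreshold r d k m num den) (hkm : k < m) (hr : r m)
    (hm : num * ((m : ℝ) - k) < (d k - d m) * den) :
    IsThreshold r d k (m + 1) (d k - d m) ((m : ℝ) - k) := by
  have hkm' : (0 : ℝ) < m - k := sub_pos.2 (by exact_mod_cast hkm)
  have hpos : 0 < d k - d m :=
    pos_of_mul_pos_left ((mul_nonneg h.num_nonneg hkm'.le).trans_lt hm) h.den_pos.le
  refine ⟨hkm', hpos.le, fun j hj hkj hrj => ?_, .inr ⟨m, m.lt_succ_self, hkm, hr, rfl, rfl⟩⟩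
  rcases Nat.lt_succ_iff_lt_or_eq.1 hj with hj | rfl
  · have hkj' : (0 : ℝ) < j - k := sub_pos.2 (by exact_mod_cast hkj)
    have h1 := mul_le_mul_of_nonneg_right (h.le j hj hkj hrj) hkm'.le
    have h2 := mul_le_mul_of_nonneg_right hm.le hkj'.le
    refine le_of_mul_le_mul_right ?_ h.den_pos
    linarith
  · exact le_rfl

/-- Larger indices and `lam ≥ 0` bound `lam` from below, smaller indices from above. The least value
allowed by the lower bounds, `num / den`, is therefore the best witness. -/
theorem isBreak (h : IsThreshold r d k n num den) (hk : r k)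
    (hlt : ∀ j < k, r j → num * ((k : ℝ) - j) < (d j - d k) * den) : IsBreak n r d k := by
  have hd := h.den_pos
  refine ⟨hk, num / den, div_nonneg h.num_nonneg hd.le, fun j hj hkj hr => ?_, fun j hj hr => ?_⟩
  · rw [div_mul_eq_mul_div, le_div_iff₀ hd]
    exact h.le j hj hkj hr
  · rw [div_mul_eq_mul_div, div_lt_iff₀ hd]
    exact hlt j hj hr

/-- Any admissible `lam` is at least `num / den`, since that maximum is attained; an upper bound
violated there is violated by every admissible `lam`. -/
theorem not_isBreak (h : IsThreshold r d k n num den) {j : ℕ} (hj : j < k) (hr : r j)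
    (hle : (d j - d k) * den ≤ num * ((k : ℝ) - j)) : ¬ IsBreak n r d k := by
  rintro ⟨-, lam, hl, hgt, hlt⟩
  have hd := h.den_pos
  have hkj : (0 : ℝ) < k - j := sub_pos.2 (by exact_mod_cast hj)
  have h1 : num ≤ lam * den := by
    rcases h.attained with h0 | ⟨i, hi, hki, hri, h2, h3⟩
    · rw [h0]; positivity
    · rw [h2, h3]; exact hgt i hi hki hri
  have h2 := mul_lt_mul_of_pos_right (hlt j hj hr) hd
  have h3 := mul_le_mul_of_nonneg_right h1 hkj.le
  linarith

end IsThreshold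

namespace PathInstance

variable {G : PathInstance} {nx : ℕ → ℕ → ℕ} {ds : ℕ → ℕ → ℝ}

/-- The table `nx` with the breakpoints below `k` marked in row `N`. -/
noncomputable def flagged (G : PathInstance) (nx : ℕ → ℕ → ℕ) (ds : ℕ → ℕ → ℝ) (k : ℕ) :
    ℕ → ℕ → ℕ :=
  Function.update nx G.N fun j => if j ∈ G.breaks nx ds k then 1 else 0

theorem flagged_zero (h : nx G.N = 0) : G.flagged nx ds 0 = nx := by
  rw [flagged, Function.update_eq_self_iff, h]
  ext; simp [breaks]

theorem flagged_of_lt {j : ℕ} (k : ℕ) (hj : j < G.N) : G.flagged nx ds k j = nx j := by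
  simp [flagged, hj.ne]

theorem flagged_row (k j : ℕ) :
    G.flagged nx ds k G.N j = if j ∈ G.breaks nx ds k then 1 else 0 := by
  simp [flagged]

theorem breaks_succ_of_isBreak {k : ℕ}
    (h : IsBreak G.N (fun j => nx j G.source ≠ 0) (fun j => ds j G.source) k) :
    G.breaks nx ds (k + 1) = G.breaks nx ds k ++ [k] := by
  simp [breaks, List.range_succ, h]

theorem breaks_succ_of_not_isBreak {k : ℕ}
    (h : ¬ IsBreak G.N (fun j => nx j G.source ≠ 0) (fun j => ds j G.source) k) :
    G.breaks nx ds (k + 1) = G.breaks nx ds k := by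
  simp [breaks, List.range_succ, h]

theorem flagged_succ_of_isBreak {k : ℕ}
    (h : IsBreak G.N (fun j => nx j G.source ≠ 0) (fun j => ds j G.source) k) :
    G.flagged nx ds (k + 1) = setEntry (G.flagged nx ds k) G.N k 1 := by
  rw [flagged, flagged, setEntry, Function.update_idem, Function.update_self,
    breaks_succ_of_isBreak h]
  congr 1
  ext j
  by_cases hj : j = k <;> simp [hj]

theorem flagged_succ_of_not_isBreak {k : ℕ}
    (h : ¬ IsBreak G.N (fun j => nx j G.source ≠ 0) (fun j => ds j G.source) k) :
    G.flagged nx ds (k + 1) = G.flagged nx ds k := by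
  rw [flagged, flagged, breaks_succ_of_not_isBreak h]

/-- The registers while index `k` is tested, with `c` breakpoints found so far. -/
structure SelRegs (G : PathInstance) (k c : ℕ) (I : ℕ → ℕ) (R : ℕ → ℝ) : Prop
    extends Consts G I where
  flags : I 9 = 2 * G.M + G.N * G.N
  index : I 11 = k
  ientry : I 6 = 2 * G.M + k * G.N + G.source
  rentry : I 8 = G.M + k * G.N + G.source
  count : I 19 = c
  rone : R 3 = 1
  rindex : R 10 = k

/-- The configurations at the head of the loop over the indices. -/
def SelLoop (G : PathInstance) (nx : ℕ → ℕ → ℕ) (ds : ℕ → ℕ → ℝ) (k : ℕ) (σ : Config) : Prop :=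
  ∃ I R, σ = ⟨46, I, R, G.imemOf (G.flagged nx ds k), G.rmemOf ds, []⟩ ∧
    SelRegs G k (G.breaks nx ds k).length I R

/-- The configurations at the end of the test of index `k`. -/
def SelNext (G : PathInstance) (nx : ℕ → ℕ → ℕ) (ds : ℕ → ℕ → ℝ) (k : ℕ) (σ : Config) : Prop :=
  ∃ I R, σ = ⟨94, I, R, G.imemOf (G.flagged nx ds (k + 1)), G.rmemOf ds, []⟩ ∧
    SelRegs G k (G.breaks nx ds (k + 1)).length I R

/-- The registers while index `k` is compared with index `m`. -/
structure CmpRegs (G : PathInstance) (nx : ℕ → ℕ → ℕ) (ds : ℕ → ℕ → ℝ) (k m : ℕ) (I : ℕ → ℕ)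
    (R : ℕ → ℝ) : Prop extends SelRegs G k (G.breaks nx ds k).length I R where
  other : I 12 = m
  iother : I 13 = 2 * G.M + m * G.N + G.source
  rother : I 14 = G.M + m * G.N + G.source
  dist : R 1 = ds k G.source

/-- The configurations at the head of the loop over the larger indices. -/
def AboveLoop (G : PathInstance) (nx : ℕ → ℕ → ℕ) (ds : ℕ → ℕ → ℝ) (k m : ℕ) (σ : Config) :
    Prop :=
  ∃ I R, σ = ⟨56, I, R, G.imemOf (G.flagged nx ds k), G.rmemOf ds, []⟩ ∧
    CmpRegs G nx ds k m I R ∧ R 6 = (m : ℝ) - k ∧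
    IsThreshold (fun j => nx j G.source ≠ 0) (fun j => ds j G.source) k m (R 4) (R 5)

theorem aboveLoop_step {k m : ℕ} (hkm : k < m) (hm : m < G.N) {σ : Config}
    (hσ : AboveLoop G nx ds k m σ) : Ends program σ 16 (AboveLoop G nx ds k (m + 1)) := by
  obtain ⟨I, R, rfl, ⟨⟨⟨c0, c1, c2, c3, c4, c5⟩, i9, i11, i6, i8, i19, r3, r10⟩,
    i12, i13, i14, r1⟩, r6, hT⟩ := hσ
  refine .iskip rfl (by simp [*]) ?_
  refine .iload (x := nx m G.source) rfl
    (by rw [i13, imemOf_table _ _ G.source.2, flagged_of_lt _ hm]) ?_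
  refine .rload (z := ds m G.source) rfl (by simp [*, rmemOf_table]) ?_
  refine .iadd (x := m + 1) rfl (by simp [*]) ?_
  refine .iadd (x := 2 * G.M + (m + 1) * G.N + G.source) rfl (by simp [*]; ring) ?_
  refine .iadd (x := G.M + (m + 1) * G.N + G.source) rfl (by simp [*]; ring) ?_
  refine .rcopy (z := (m : ℝ) - k) rfl (by simp [*]) ?_
  -- No instruction turns a natural number into a real, so index differences are updated in a real
  -- register.
  refine .radd (z := ((m + 1 : ℕ) : ℝ) - k) rfl (by simp [*]; ring) ?_
  by_cases h0 : nx m G.source = 0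
  · refine .ijump rfl (by simp [*]) (.done ⟨_, _, rfl, ⟨⟨⟨by simpa, by simpa, by simpa, by simpa,
      by simpa, by simpa⟩, by simpa, by simpa, by simpa, by simpa, by simpa, by simpa, by simpa⟩,
      by simp, by simp, by simp, by simpa⟩, by simp, ?_⟩)
    simpa using hT.skip fun h => absurd h0 h
  refine .iskip rfl (by simp [*]; omega) ?_
  refine .rsub (z := ds k G.source - ds m G.source) rfl (by simp [*]) ?_
  refine .rmul (z := (ds k G.source - ds m G.source) * R 5) rfl (by simp) ?_
  refine .rmul (z := R 4 * ((m : ℝ) - k)) rfl (by simp) ?_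
  by_cases hle : (ds k G.source - ds m G.source) * R 5 ≤ R 4 * ((m : ℝ) - k)
  · refine .rjump rfl (by simpa) (.done ⟨_, _, rfl, ⟨⟨⟨by simpa, by simpa, by simpa, by simpa,
      by simpa, by simpa⟩, by simpa, by simpa, by simpa, by simpa, by simpa, by simpa, by simpa⟩,
      by simp, by simp, by simp, by simpa⟩, by simp, ?_⟩)
    simpa using hT.skip fun _ => hle
  refine .rskip rfl (by simpa using hle) ?_
  refine .rcopy (z := ds k G.source - ds m G.source) rfl (by simp) ?_
  refine .rcopy (z := (m : ℝ) - k) rfl (by simp) ?_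
  refine .ijump rfl le_rfl (.done ⟨_, _, rfl, ⟨⟨⟨by simpa, by simpa, by simpa, by simpa,
      by simpa, by simpa⟩, by simpa, by simpa, by simpa, by simpa, by simpa, by simpa, by simpa⟩,
      by simp, by simp, by simp, by simpa⟩, by simp, ?_⟩)
  simpa using hT.replace hkm h0 (not_le.1 hle)

/-- The configurations at the head of the loop over the smaller indices, or after its early
exit. -/
def BelowLoop (G : PathInstance) (nx : ℕ → ℕ → ℕ) (ds : ℕ → ℕ → ℝ) (k m : ℕ) (σ : Config) :
    Prop :=
  SelNext G nx ds k σ ∨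
  ∃ I R, σ = ⟨77, I, R, G.imemOf (G.flagged nx ds k), G.rmemOf ds, []⟩ ∧
    CmpRegs G nx ds k m I R ∧ R 6 = (k : ℝ) - m ∧
    IsThreshold (fun j => nx j G.source ≠ 0) (fun j => ds j G.source) k G.N (R 4) (R 5) ∧
    ∀ j < m, nx j G.source ≠ 0 →
      R 4 * ((k : ℝ) - j) < (ds j G.source - ds k G.source) * R 5

theorem belowLoop_step {k m : ℕ} (hmk : m < k) (hk : k < G.N) {σ : Config}
    (hσ : BelowLoop G nx ds k m σ) : Ends program σ 14 (BelowLoop G nx ds k (m + 1)) := by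
  obtain hσ | ⟨I, R, rfl, ⟨⟨⟨c0, c1, c2, c3, c4, c5⟩, i9, i11, i6, i8, i19, r3, r10⟩,
    i12, i13, i14, r1⟩, r6, hT, hlt⟩ := hσ
  · exact .done (.inl hσ)
  refine .iskip rfl (by simp [*]) ?_
  refine .iload (x := nx m G.source) rfl
    (by rw [i13, imemOf_table _ _ G.source.2, flagged_of_lt _ (hmk.trans hk)]) ?_
  refine .rload (z := ds m G.source) rfl (by simp [*, rmemOf_table]) ?_
  refine .iadd (x := m + 1) rfl (by simp [*]) ?_
  refine .iadd (x := 2 * G.M + (m + 1) * G.N + G.source) rfl (by simp [*]; ring) ?_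
  refine .iadd (x := G.M + (m + 1) * G.N + G.source) rfl (by simp [*]; ring) ?_
  refine .rcopy (z := (k : ℝ) - m) rfl (by simp [*]) ?_
  refine .rsub (z := (k : ℝ) - (m + 1 : ℕ)) rfl (by simp [*]; ring) ?_
  by_cases h0 : nx m G.source = 0
  · refine .ijump rfl (by simp [*]) (.done (.inr ⟨_, _, rfl, ⟨⟨⟨by simpa, by simpa, by simpa,
      by simpa, by simpa, by simpa⟩, by simpa, by simpa, by simpa, by simpa, by simpa, by simpa,
      by simpa⟩, by simp, by simp, by simp, by simpa⟩, by simp, by simpa, fun j hj hr => ?_⟩))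
    rcases Nat.lt_succ_iff_lt_or_eq.1 hj with hj | rfl
    · simpa using hlt j hj hr
    · exact absurd h0 hr
  refine .iskip rfl (by simp [*]; omega) ?_
  refine .rsub (z := ds m G.source - ds k G.source) rfl (by simp [*]) ?_
  refine .rmul (z := (ds m G.source - ds k G.source) * R 5) rfl (by simp) ?_
  refine .rmul (z := R 4 * ((k : ℝ) - m)) rfl (by simp) ?_
  by_cases hle : (ds m G.source - ds k G.source) * R 5 ≤ R 4 * ((k : ℝ) - m)
  -- One failing comparison rejects `k` for good, so the jump leaves the loop without setting a
  -- mark.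
  · have hB := hT.not_isBreak hmk h0 hle
    refine .rjump rfl (by simpa) (.done (.inl ?_))
    rw [← flagged_succ_of_not_isBreak hB]
    rw [← breaks_succ_of_not_isBreak hB] at i19
    exact ⟨_, _, rfl, ⟨by simpa, by simpa, by simpa, by simpa, by simpa, by simpa⟩,
      by simpa, by simpa, by simpa, by simpa, by simpa, by simpa, by simpa⟩
  refine .rskip rfl (by simpa using hle) ?_
  refine .ijump rfl le_rfl (.done (.inr ⟨_, _, rfl, ⟨⟨⟨by simpa, by simpa, by simpa,
      by simpa, by simpa, by simpa⟩, by simpa, by simpa, by simpa, by simpa, by simpa, by simpa,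
      by simpa⟩, by simp, by simp, by simp, by simpa⟩, by simp, by simpa, fun j hj hr => ?_⟩))
  rcases Nat.lt_succ_iff_lt_or_eq.1 hj with hj | rfl
  · simpa using hlt j hj hr
  · simpa using hle

theorem selNext_of_aboveLoop {k : ℕ} (hk : k < G.N) (hr : nx k G.source ≠ 0) {σ : Config}
    (hσ : AboveLoop G nx ds k G.N σ) : Ends program σ (6 + k * 14 + 4) (SelNext G nx ds k) := by
  refine Ends.trans (Q := BelowLoop G nx ds k k) (Ends.trans (Q := BelowLoop G nx ds k 0) ?_
    fun τ hτ => Ends.loop (I := BelowLoop G nx ds k) k.zero_le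
      (fun m _ hm υ hυ => belowLoop_step hm hk hυ) hτ) ?_
  · obtain ⟨I, R, rfl, ⟨⟨⟨c0, c1, c2, c3, c4, c5⟩, i9, i11, i6, i8, i19, r3, r10⟩,
      i12, i13, i14, r1⟩, r6, hT⟩ := hσ
    refine .ijump rfl (by simp [*]) (.iconst rfl ?_)
    refine .iadd (x := 2 * G.M) rfl (by simp [*]; ring) ?_
    refine .iadd (x := 2 * G.M + G.source) rfl (by simp [*]) ?_
    refine .iadd (x := G.M + G.source) rfl (by simp [*]) ?_
    refine .rcopy (z := k) rfl (by simp [*]) (.done (.inr ?_))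
    exact ⟨_, _, rfl, ⟨⟨⟨by simpa, by simpa, by simpa, by simpa,
      by simpa, by simpa⟩, by simpa, by simpa, by simpa, by simpa, by simpa, by simpa, by simpa⟩,
      by simp, by simp, by simp, by simpa⟩, by simp, by simpa, by simp⟩
  · rintro _ (hσ | ⟨I, R, rfl, ⟨⟨⟨c0, c1, c2, c3, c4, c5⟩, i9, i11, i6, i8, i19, r3, r10⟩,
      i12, i13, i14, r1⟩, r6, hT, hlt⟩)
    · exact .done hσ
    have hB := hT.isBreak hr hlt
    refine .ijump rfl (by simp [*]) ?_
    refine .iadd (x := 2 * G.M + G.N * G.N + k) rfl (by simp [*]) ?_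
    refine .istore (A' := G.imemOf (G.flagged nx ds (k + 1))) rfl ?_ ?_
    · rw [flagged_succ_of_isBreak hB, ← update_imemOf _ _ hk]
      simp [*]
    refine .iadd (x := (G.breaks nx ds (k + 1)).length) rfl ?_ (.done ?_)
    · simp [*, breaks_succ_of_isBreak hB]
    exact ⟨_, _, rfl, ⟨by simpa, by simpa, by simpa, by simpa, by simpa, by simpa⟩,
      by simpa, by simpa, by simpa, by simpa, by simp, by simpa, by simpa⟩

theorem selNext_of_selLoop {k : ℕ} (hk : k < G.N) {σ : Config} (hσ : SelLoop G nx ds k σ) :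
    Ends program σ (10 + (G.N - (k + 1)) * 16 + (6 + k * 14 + 4)) (SelNext G nx ds k) := by
  obtain ⟨I, R, rfl, ⟨⟨c0, c1, c2, c3, c4, c5⟩, i9, i11, i6, i8, i19, r3, r10⟩⟩ := hσ
  rw [show 10 + (G.N - (k + 1)) * 16 + (6 + k * 14 + 4)
    = (7 + (G.N - (k + 1)) * 16 + (6 + k * 14 + 4)) + 1 + 1 + 1 by ring]
  refine .iskip rfl (by simp [*]) ?_
  refine .iload (x := nx k G.source) rfl
    (by rw [i6, imemOf_table _ _ G.source.2, flagged_of_lt _ hk]) ?_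
  by_cases h0 : nx k G.source = 0
  · have hB : ¬ IsBreak G.N (fun j => nx j G.source ≠ 0) (fun j => ds j G.source) k :=
      fun h => h.1 h0
    refine .ijump rfl (by simp [*]) (.done ?_)
    rw [← flagged_succ_of_not_isBreak hB]
    rw [← breaks_succ_of_not_isBreak hB] at i19
    exact ⟨_, _, rfl, ⟨by simpa, by simpa, by simpa, by simpa, by simpa, by simpa⟩,
      by simpa, by simpa, by simpa, by simpa, by simpa, by simpa, by simpa⟩
  refine .iskip rfl (by simp [*]; omega) (Ends.trans (Q := AboveLoop G nx ds k G.N)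
    (Ends.trans (Q := AboveLoop G nx ds k (k + 1)) ?_ fun τ hτ =>
      Ends.loop (I := AboveLoop G nx ds k) hk
        (fun m hkm hm υ hυ => aboveLoop_step hkm hm hυ) hτ)
    fun τ hτ => selNext_of_aboveLoop hk h0 hτ)
  refine .rload (z := ds k G.source) rfl (by simp [*, rmemOf_table]) ?_
  refine .rconst (z := 0) rfl (by simp) ?_
  refine .rconst (z := 1) rfl (by simp) ?_
  refine .iadd (x := k + 1) rfl (by simp [*]) ?_
  refine .iadd (x := 2 * G.M + (k + 1) * G.N + G.source) rfl (by simp [*]; ring) ?_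
  refine .iadd (x := G.M + (k + 1) * G.N + G.source) rfl (by simp [*]; ring) ?_
  refine .rcopy (z := 1) rfl (by simp [*]) (.done ?_)
  exact ⟨_, _, rfl, ⟨⟨⟨by simpa, by simpa, by simpa, by simpa,
      by simpa, by simpa⟩, by simpa, by simpa, by simpa, by simpa, by simpa, by simpa, by simpa⟩,
      by simp, by simp, by simp, by simp⟩, by simp, by simpa using .init _ _ _⟩

theorem selLoop_step {k : ℕ} (hk : k < G.N) {σ : Config} (hσ : SelLoop G nx ds k σ) :
    Ends program σ (G.N * 16 + 25) (SelLoop G nx ds (k + 1)) := by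
  refine Ends.mono (Ends.trans (T' := 5) (selNext_of_selLoop hk hσ) ?_) (by omega) fun _ h => h
  rintro _ ⟨I, R, rfl, ⟨⟨c0, c1, c2, c3, c4, c5⟩, i9, i11, i6, i8, i19, r3, r10⟩⟩
  refine .iadd (x := k + 1) rfl (by simp [*]) ?_
  refine .iadd (x := 2 * G.M + (k + 1) * G.N + G.source) rfl (by simp [*]; ring) ?_
  refine .iadd (x := G.M + (k + 1) * G.N + G.source) rfl (by simp [*]; ring) ?_
  refine .radd (z := (k + 1 : ℕ)) rfl (by simp [*]) ?_
  refine .ijump rfl le_rfl (.done ?_)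
  exact ⟨_, _, rfl, ⟨by simpa, by simpa, by simpa, by simpa, by simpa, by simpa⟩,
      by simpa, by simp, by simp, by simp, by simpa, by simpa, by simp⟩

/-- The situation after the second phase. -/
def SelDone (G : PathInstance) (nx : ℕ → ℕ → ℕ) (ds : ℕ → ℕ → ℝ) (σ : Config) : Prop :=
  ∃ I R, σ = ⟨99, I, R, G.imemOf (G.flagged nx ds G.N), G.rmemOf ds, []⟩ ∧
    Consts G I ∧ I 9 = 2 * G.M + G.N * G.N ∧ I 19 = (G.breaks nx ds G.N).length

theorem selDone {I : ℕ → ℕ} {R : ℕ → ℝ} (hI : Consts G I) (i9 : I 9 = 2 * G.M + G.N * G.N)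
    (hnx : nx G.N = 0) : Ends program ⟨39, I, R, G.imemOf nx, G.rmemOf ds, []⟩
      (7 + G.N * (G.N * 16 + 25) + 1) (SelDone G nx ds) := by
  refine Ends.trans (Q := SelLoop G nx ds G.N) (Ends.trans (Q := SelLoop G nx ds 0) ?_
    fun τ hτ => Ends.loop (I := SelLoop G nx ds) G.N.zero_le
      (fun k _ hk υ hυ => selLoop_step hk hυ) hτ) ?_
  · obtain ⟨c0, c1, c2, c3, c4, c5⟩ := hI
    refine .iconst rfl (.iconst rfl ?_)
    refine .iadd (x := 2 * G.M) rfl (by simp [*]; ring) ?_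
    refine .iadd (x := 2 * G.M + G.source) rfl (by simp [*]) ?_
    refine .iadd (x := G.M + G.source) rfl (by simp [*]) ?_
    refine .rconst (z := 1) rfl (by simp) ?_
    refine .rconst (z := 0) rfl (by simp) (.done ?_)
    rw [SelLoop, flagged_zero hnx]
    exact ⟨_, _, rfl, ⟨by simpa, by simpa, by simpa, by simpa, by simpa, by simpa⟩,
      by simpa, by simp, by simp, by simp, by simp [breaks], by simp, by simp⟩
  · rintro _ ⟨I, R, rfl, ⟨⟨c0, c1, c2, c3, c4, c5⟩, i9, i11, i6, i8, i19, r3, r10⟩⟩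
    exact .ijump rfl (by simp [*]) (.done ⟨I, R, rfl, ⟨c0, c1, c2, c3, c4, c5⟩, i9, i19⟩)

end PathInstance

end VarRobust

namespace VarRobust

namespace PathInstance

variable {G : PathInstance} {nx : ℕ → ℕ → ℕ} {ds : ℕ → ℕ → ℝ}

/-! ### The output -/

/-- The code of the walk with `k` edges from the source described by the table. -/
def walkCode (G : PathInstance) (nx : ℕ → ℕ → ℕ) (k : ℕ) : List ℕ :=
  k :: (G.follow nx k G.source).map (fun e => (e : ℕ))

/-- The registers while the walk with `k` edges is considered for output. -/
structure OutRegs (G : PathInstance) (k : ℕ) (I : ℕ → ℕ) : Prop extends Consts G I where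
  flags : I 9 = 2 * G.M + G.N * G.N
  index : I 11 = k
  irow : I 6 = 2 * G.M + k * G.N

/-- The marks occupy row `N` only, so the rows read here are those of `nx`. Each edge costs eleven
instructions, and the recursion mirrors `follow`. -/
theorem ends_follow (hT : G.IsTable (G.N - 1) nx ds) {k c : ℕ} {R : ℕ → ℝ} {B : ℕ → ℝ} :
    ∀ (j : ℕ) (v : Fin G.N) (I : ℕ → ℕ) (o : List ℕ), j < G.N → nx j v ≠ 0 → OutRegs G k I →
      I 12 = j → I 13 = 2 * G.M + j * G.N → I 14 = v →
      Ends program ⟨110, I, R, G.imemOf (G.flagged nx ds c), B, o⟩ (j * 11 + 1) fun τ =>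
        ∃ I', τ = ⟨121, I', R, G.imemOf (G.flagged nx ds c), B,
          o ++ (G.follow nx j v).map (fun e => (e : ℕ))⟩ ∧ OutRegs G k I'
  | 0, v, I, o, _, _, hI, i12, _, _ => by
    refine .ijump rfl (by simp [i12]) (.done ⟨I, ?_, hI⟩)
    simp [follow]
  | j + 1, v, I, o, hj, hv, ⟨⟨c0, c1, c2, c3, c4, c5⟩, i9, i11, i6⟩, i12, i13, i14 => by
    obtain ⟨e, h1, rfl, h3, -, h5⟩ := hT.exists_edge (by omega) hv
    rw [show (j + 1) * 11 + 1 = (j * 11 + 1) + 11 by ring]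
    refine .iskip rfl (by simp [*]) ?_
    refine .iadd (x := 2 * G.M + (j + 1) * G.N + G.tail e) rfl (by simp [*]) ?_
    refine .iload (x := e + 1) rfl
      (by rw [Function.update_self, imemOf_table _ _ (G.tail e).2, flagged_of_lt _ hj, h1]) ?_
    refine .isub (x := e) rfl (by simp [*]) ?_
    refine .output (x := e) rfl (by simp) ?_
    refine .iadd (x := 2 * e) rfl (by simp; ring) ?_
    refine .iadd (x := 2 * e + 1) rfl (by simp [*]) ?_
    refine .iload (x := G.head e) rfl (by simp [imemOf_head]) ?_
    refine .isub (x := j) rfl (by simp [*]) ?_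
    refine .isub (x := 2 * G.M + j * G.N) rfl
      (by simp [*, Nat.add_mul, ← Nat.add_assoc]) ?_
    refine .ijump rfl le_rfl (.mono (ends_follow hT j (G.head e) _ (o ++ [(e : ℕ)]) (by omega) h3
      ⟨⟨by simpa, by simpa, by simpa, by simpa, by simpa, by simpa⟩, by simpa, by simpa, by simpa⟩
      (by simp) (by simp) (by simp)) le_rfl fun τ hτ => ?_)
    rw [h5]
    simpa using hτ

/-- The configurations at the head of the output loop. -/
def OutLoop (G : PathInstance) (nx : ℕ → ℕ → ℕ) (ds : ℕ → ℕ → ℝ) (k : ℕ) (σ : Config) : Prop :=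
  ∃ I R, σ = ⟨102, I, R, G.imemOf (G.flagged nx ds G.N), G.rmemOf ds,
    (G.breaks nx ds G.N).length :: (G.breaks nx ds k).flatMap (G.walkCode nx)⟩ ∧ OutRegs G k I

theorem outLoop_step (hT : G.IsTable (G.N - 1) nx ds) {k : ℕ} (hk : k < G.N) {σ : Config}
    (hσ : OutLoop G nx ds k σ) : Ends program σ (G.N * 11 + 12) (OutLoop G nx ds (k + 1)) := by
  obtain ⟨I, R, rfl, ⟨c0, c1, c2, c3, c4, c5⟩, i9, i11, i6⟩ := hσ
  refine Ends.mono (T := k * 11 + 1 + 3 + 8) (Ends.trans (T := k * 11 + 1 + 8) (T' := 3)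
    (Q := fun τ => ∃ I', τ = ⟨121, I', R, G.imemOf (G.flagged nx ds G.N), G.rmemOf ds,
      (G.breaks nx ds G.N).length :: (G.breaks nx ds (k + 1)).flatMap (G.walkCode nx)⟩ ∧
        OutRegs G k I') ?_ ?_) (by omega) fun _ h => h
  · refine .iskip rfl (by simp [*]) ?_
    refine .iadd (x := 2 * G.M + G.N * G.N + k) rfl (by simp [*]) ?_
    refine .iload (x := if k ∈ G.breaks nx ds G.N then 1 else 0) rfl
      (by rw [Function.update_self, imemOf_table _ _ hk, flagged_row]) ?_
    by_cases hB : IsBreak G.N (fun j => nx j G.source ≠ 0) (fun j => ds j G.source) k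
    · have hmem : k ∈ G.breaks nx ds G.N := mem_breaks.2 ⟨hk, hB⟩
      rw [if_pos hmem]
      refine .iskip rfl (by simp [*]) ?_
      refine .output (x := k) rfl (by simp [*]) ?_
      refine .icopy (x := k) rfl (by simp [*]) ?_
      refine .icopy (x := 2 * G.M + k * G.N) rfl (by simp [*]) ?_
      refine .icopy (x := G.source) rfl (by simp [*]) ?_
      refine .mono (ends_follow (k := k) hT k G.source _ _ hk hB.1
        ⟨⟨by simpa, by simpa, by simpa, by simpa, by simpa, by simpa⟩, by simpa, by simpa,
          by simpa⟩ (by simp) (by simp) (by simp)) le_rfl fun τ hτ => ?_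
      simpa [breaks_succ_of_isBreak hB, walkCode] using hτ
    · have hmem : k ∉ G.breaks nx ds G.N := fun h => hB (mem_breaks.1 h).2
      rw [if_neg hmem]
      refine .ijump rfl (by simp) (.done ?_)
      rw [breaks_succ_of_not_isBreak hB]
      exact ⟨_, rfl, ⟨by simpa, by simpa, by simpa, by simpa, by simpa, by simpa⟩, by simpa,
        by simpa, by simpa⟩
  · rintro _ ⟨I, rfl, ⟨c0, c1, c2, c3, c4, c5⟩, i9, i11, i6⟩
    refine .iadd (x := k + 1) rfl (by simp [*]) ?_
    refine .iadd (x := 2 * G.M + (k + 1) * G.N) rfl (by simp [*]; ring) ?_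
    refine .ijump rfl le_rfl (.done ⟨_, _, rfl, ⟨by simpa, by simpa, by simpa, by simpa, by simpa,
      by simpa⟩, by simpa, by simp, by simp⟩)

theorem ends_output (hT : G.IsTable (G.N - 1) nx ds) {σ : Config} (hσ : SelDone G nx ds σ) :
    Ends program σ (3 + G.N * (G.N * 11 + 12) + 1) fun τ => τ.pc = 124 ∧
      τ.out = G.encodePaths ((G.breaks nx ds G.N).map fun k => G.follow nx k G.source) := by
  refine Ends.trans (Q := OutLoop G nx ds G.N) (Ends.trans (Q := OutLoop G nx ds 0) ?_
    fun τ hτ => Ends.loop (I := OutLoop G nx ds) G.N.zero_le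
      (fun k _ hk υ hυ => outLoop_step hT hk hυ) hτ) ?_
  · obtain ⟨I, R, rfl, ⟨c0, c1, c2, c3, c4, c5⟩, i9, i19⟩ := hσ
    refine .output (x := (G.breaks nx ds G.N).length) rfl i19 (.iconst rfl ?_)
    refine .iadd (x := 2 * G.M) rfl (by simp [*]; ring) (.done ?_)
    exact ⟨_, _, rfl, ⟨by simpa, by simpa, by simpa, by simpa, by simpa, by simpa⟩, by simpa,
      by simp, by simp⟩
  · rintro _ ⟨I, R, rfl, hI, i9, i11, i6⟩
    refine .ijump rfl (by rw [i11, hI.nodes]) (.done ⟨rfl, ?_⟩)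
    simp only [encodePaths, List.length_map, List.flatMap_map]
    congr 1
    refine List.flatMap_congr fun k hk => ?_
    obtain ⟨hkN, hkB⟩ := mem_breaks.1 hk
    -- The program prints `k` where the encoding asks for the length of the walk.
    rw [walkCode, (hT.follow_spec k _ (by omega) hkB.1).2.1]

theorem exists_table_haltsIn (G : PathInstance) : ∃ nx ds, G.IsTable (G.N - 1) nx ds ∧
    ∃ n ≤ 22 * (G.N * G.M) + 74 * G.N ^ 2 + 21, HaltsIn program G.initConfig n
      (G.encodePaths ((G.breaks nx ds G.N).map fun k => G.follow nx k G.source)) := by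
  obtain ⟨n, hn, τ, h1, I, R, nx, ds, rfl, hI, i9, hT, hnx⟩ := tableDone (G := G)
  obtain ⟨n', hn', τ', h1', hpc, hout⟩ :=
    (selDone (ds := ds) (R := R) hI i9 hnx).trans fun τ hτ => ends_output hT hτ
  refine ⟨nx, ds, hT, n + n', ?_, τ', ?_, by rw [hpc]; rfl, hout⟩
  -- The quadratic terms contribute `16 + 11`, and the linear ones `(10 + 25 + 12) * N` are at most
  -- `47 * N ^ 2` because `N ≥ 1`.
  · nlinarith [G.source.pos]
  · rw [Ends.run_add, h1]
    exact h1'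

end PathInstance

end VarRobust

/-! ### The asymptotic running time -/

/-- For `n ≥ 2` it suffices that `log 2 > 1 / 2`; the summand `1` pays for `n = 1`. -/
theorem Nat.cast_sq_le_two_mul_sq_mul_log (n : ℕ) :
    (n : ℝ) ^ 2 ≤ 2 * ((n : ℝ) ^ 2 * Real.log n) + 1 := by
  rcases Nat.lt_or_ge n 2 with hn | hn
  · interval_cases n <;> simp
  · have h1 : Real.log 2 ≤ Real.log n :=
      Real.log_le_log two_pos (by exact_mod_cast hn)
    have h2 := Real.log_two_gt_d9
    nlinarith [sq_nonneg (n : ℝ)]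

theorem mainTheorem7 :
    ∃ (P : List VarRobust.Instr) (C : ℝ),
      ∀ G : VarRobust.PathInstance,
        (∀ e, 0 ≤ G.cost e) →
        (∃ p, G.IsPath p) →
        ∃ (n : ℕ) (ps : List (List (Fin G.M))) (S : Set (Fin G.M → ℝ)),
          VarRobust.HaltsIn P G.initConfig n (G.encodePaths ps) ∧
          (n : ℝ) ≤ C * ((G.N : ℝ) * G.M + (G.N : ℝ) ^ 2 * Real.log G.N + 1) ∧
          (∀ p ∈ ps, G.IsPath p) ∧
          S = {x | ∃ p ∈ ps, x = G.incidence p} ∧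
          (ps.length : ℕ∞) = S.encard ∧
          VarRobust.IsSolution G.feasibleSet G.cost
            (VarRobust.constantGrowthBox (Fin G.M)) S ∧
          S.encard ≤ G.N := by
  -- Replacing `N ^ 2` in the step count gives coefficients `22`, `2 * 74 = 148` and `74 + 21 = 95`,
  -- all below `150`.
  refine ⟨VarRobust.program, 150, fun G hc hp => ?_⟩
  obtain ⟨nx, ds, hT, n, hn, hhalt⟩ := G.exists_table_haltsIn
  have hS := hT.isSolution hc hp rfl
  refine ⟨n, (G.breaks nx ds G.N).map fun k => G.follow nx k G.source, _, hhalt, ?_, ?_, ?_,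
    by simpa using hS.1, hS.2.1, hS.2.2⟩
  · have h1 : (n : ℝ) ≤ 22 * (G.N * G.M) + 74 * (G.N : ℝ) ^ 2 + 21 := by exact_mod_cast hn
    have h2 := Nat.cast_sq_le_two_mul_sq_mul_log G.N
    have h3 : (0 : ℝ) ≤ G.N * G.M := by positivity
    have h4 : 0 ≤ (G.N : ℝ) ^ 2 * Real.log G.N :=
      mul_nonneg (sq_nonneg _) (Real.log_natCast_nonneg _)
    linarith
  · simpa using fun k hk => hT.isPath_follow hc hk
  · ext x
    simp [eq_comm]
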